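/- Graphs are finite, in the sense of Serre (loops and multiple edges allowed). Let $X$ be a connected graph with edge set $E(X)$ and genus $g=|E(X)|-|V(X)|+1$, let $G$ be a finite abelian group, let $p:\widetilde X\to X$ be a free Galois cover with group $G$ (that is, $p$ is a covering and $G$ acts on $\widetilde X$ over $X$, freely and transitively on every fiber), and let $\rho:G\to\mathbb C^*$ be a nontrivial character. Choose a base point in every vertex fiber, and let $\eta$ be the resulting voltage assignment: for every oriented edge $e$ of $X$, the lift of $e$ starting at the base point over its source ends at the translate by $\eta(e)\in G$ of the base point over its target (so $\eta(\overline e)=-\eta(e)$). For a path $P=e_1\cdots e_k$ of oriented edges put $\eta(P)=\sum_i\eta(e_i)$ and, for edge lengths $x_e$ ($e\in E(X)$), put $M(P)=\sum_i x_{e_i}$. A prime $[P]$ of $X$ is a primitive (not a proper power) closed reduced path, up to the choice of its starting point. The metric Artin $L$-function is $$L_M(s,x_e,\widetilde X/X,\rho)=\prod_{[P]}\left(1-\rho(\eta(P))\,s^{M(P)}\right)^{-1},$$ the product being over all primes of $X$. A set $F\subseteq E(X)$ is called independent if for every connected component $Y$ of $X\setminus F$ (the graph with all vertices of $X$ and the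 edges outside $F$) the restriction of $\rho(\eta)$ to $Y$ is not a coboundary, i.e. there is no $\xi:V(Y)\to\rho(G)$ with $\rho(\eta(e))=\xi(t(e))/\xi(s(e))$ for all oriented edges $e$ of $Y$ with source $s(e)$ and target $t(e)$. The maximal independent sets are the bases $\mathcal B(\mathcal M^*(\widetilde X/X,\rho))$ of the $\rho$-twisted matroid of the cover. If $F$ is a basis, every connected component $X_i$ of $X\setminus F$ has genus one; let $\eta(X_i)$ be the sum of the voltages along its unique cycle (defined up to sign), and put $$w_\rho(F)=\prod_i\left|1-\rho(\eta(X_i))\right|^2,\qquad P_{\widetilde X/X,\rho}(x_e)=\sum_{F\in\mathcal B(\mathcal M^*(\widetilde X/X,\rho))}w_\rho(F)\prod_{e\in F}x_e .$$ Let $x_e$, $e\in E(X)$, be complex numbers with positive real part (for instance positive real lengths), and let $s^{M}=\exp(M\log s)$ with the principal logarithm on $\mathbb C\setminus(-\infty,0]$. Then for all $s\in\mathbb C\setminus(-\infty,0]$ sufficiently close to $0$ the product $L_M(s,x_e,\widetilde X/X,\rho)$ converges unconditionally to a nonzero number, its reciprocal extends to a holomorphic function of $s$ on $\mathbb C\setminus(-\infty,0]$,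 and this (unique) extension, still denoted $L_M(s,x_e,\widetilde X/X,\rho)^{-1}$, satisfies as $s\to 1$ $$L_M(s,x_e,\widetilde X/X,\rho)^{-1}=2^{g-1}(-1)^{g-1}P_{\widetilde X/X,\rho}(x_e)\,(s-1)^{g-1}+O\left((s-1)^g\right).$$ -/

import Mathlib

open Filter Topology Asymptotics
open scoped Classical

noncomputable section

/-- A graph in the sense of Serre, with vertex set `V` and half-edge set `H`: a fixed-point-free
involution `bar` on the half-edges and a root map.  Loops and multiple edges are allowed.
A half-edge `h` also stands for the oriented edge `(h, bar h)`, with source `root h` and target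
`root (bar h)`; the oppositely oriented edge is `bar h`. -/
structure SGraph (V H : Type*) where
  bar : H → H
  bar_bar : ∀ h, bar (bar h) = h
  bar_ne : ∀ h, bar h ≠ h
  root : H → V

namespace SGraph

variable {V H : Type*} (X : SGraph V H)

/-- Source of the oriented edge `h`. -/
def src (h : H) : V := X.root h

/-- Target of the oriented edge `h`. -/
def tgt (h : H) : V := X.root (X.bar h)

/-- Two half-edges are equivalent when they belong to the same edge `{h, bar h}`. -/
def edgeSetoid : Setoid H where
  r h k := k = h ∨ k = X.bar h
  iseqv :=
    { refl := fun _ => Or.inl rfl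
      symm := by
        rintro h k (rfl | rfl)
        · exact Or.inl rfl
        · exact Or.inr (X.bar_bar h).symm
      trans := by
        rintro h k l (rfl | rfl) (rfl | rfl)
        · exact Or.inl rfl
        · exact Or.inr rfl
        · exact Or.inr rfl
        · exact Or.inl (X.bar_bar h) }

/-- The set `E(X)` of unoriented edges: the orbits of the involution. -/
def Edge : Type _ := Quotient X.edgeSetoid

/-- The unoriented edge underlying a half-edge. -/
def edge (h : H) : X.Edge := Quotient.mk X.edgeSetoid h

instance [Finite H] : Finite X.Edge := inferInstanceAs (Finite (Quotient X.edgeSetoid))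

instance [Fintype H] : Fintype X.Edge := Fintype.ofFinite _

/-- The genus `|E(X)| - |V(X)| + 1`, as an integer. -/
def genus [Fintype V] [Fintype H] : ℤ :=
  (Fintype.card X.Edge : ℤ) - (Fintype.card V : ℤ) + 1

/-- The adjacency relation of `X \ F`, the graph with all vertices of `X` and the edges outside `F`,
recorded as a simple graph; it is only used for connectedness and connected components, which do
not see loops and multiplicities. -/
def delete (F : Set X.Edge) : SimpleGraph V :=
  SimpleGraph.fromRel fun u v => ∃ h, X.edge h ∉ F ∧ X.src h = u ∧ X.tgt h = v

/-- `X` is connected (in particular it has a vertex). -/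
def Connected : Prop := (X.delete ∅).Connected

/-! ### Closed paths and primes -/

/-- The oriented edge `k` may follow `h` on a reduced path: it starts where `h` ends and is not
the reverse of `h`. -/
def Follows (h k : H) : Prop := X.tgt h = X.src k ∧ k ≠ X.bar h

/-- A closed reduced path `e₁ ⋯ e_k`, `k ≥ 1`: every `e_{i+1}` follows `e_i`, and `e₁` follows
`e_k`. -/
def IsClosedReduced (P : List H) : Prop := P ≠ [] ∧ Cycle.Chain X.Follows (P : Cycle H)

/-- A closed reduced path which is not a proper power `Q ⋯ Q` (`c ≥ 2` factors). When such a power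
is a closed path, so is `Q`. -/
def IsPrimitive (P : List H) : Prop :=
  X.IsClosedReduced P ∧ ∀ (Q : List H) (c : ℕ), 2 ≤ c → P ≠ (List.replicate c Q).flatten

/-- The primes of `X`: primitive paths up to the choice of the starting point (`Cycle H` is the
type of lists up to rotation). -/
def Prime : Type _ := {c : Cycle H // ∃ P : List H, X.IsPrimitive P ∧ c = (P : Cycle H)}

variable {G : Type*} [AddCommGroup G]

variable {X} in
/-- The Frobenius element `η(P)`: the sum of the voltages along a prime. -/
def Prime.frob (η : H → G) (P : X.Prime) : G := (P.1.toMultiset.map η).sum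

variable {X} in
/-- The metric length `M(P)`: the sum of the edge lengths along a prime. -/
def Prime.length (x : X.Edge → ℂ) (P : X.Prime) : ℂ :=
  (P.1.toMultiset.map fun h => x (X.edge h)).sum

/-- The Euler factor `(1 - ρ(η(P)) s^{M(P)})⁻¹`, with `s^M = exp (M log s)` for the principal
branch of the logarithm. -/
def eulerFactor (η : H → G) (ρ : AddChar G ℂ) (x : X.Edge → ℂ) (s : ℂ) (P : X.Prime) : ℂ :=
  (1 - ρ (P.frob η) * s ^ P.length x)⁻¹

/-- The metric Artin `L`-function as a product over the primes, meaningful where the product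
converges. -/
def metricL (η : H → G) (ρ : AddChar G ℂ) (x : X.Edge → ℂ) (s : ℂ) : ℂ :=
  ∏' P : X.Prime, X.eulerFactor η ρ x s P

/-- `Λ` is the reciprocal of the metric Artin `L`-function, analytically continued: it is
holomorphic on the plane slit along `(-∞, 0]`, and for all `s` in the slit plane that are close to
`0` the Euler product converges unconditionally to a nonzero number whose inverse is `Λ s`.
By the identity theorem this determines `Λ` on the slit plane. -/
structure IsMetricLInv (η : H → G) (ρ : AddChar G ℂ) (x : X.Edge → ℂ) (Λ : ℂ → ℂ) : Prop where
  differentiableOn : DifferentiableOn ℂ Λ Complex.slitPlane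
  euler : ∀ᶠ s in 𝓝[Complex.slitPlane] (0 : ℂ),
    Multipliable (X.eulerFactor η ρ x s) ∧ X.metricL η ρ x s ≠ 0 ∧ Λ s = (X.metricL η ρ x s)⁻¹

/-! ### The twisted matroid and its weight polynomial -/

/-- The connected component `C` of `X \ F` is nontrivial for the `ρ(G)`-cover given by the
`ρ(G)`-voltage assignment `ρ(η)`: the restriction of `ρ(η)` to `C` is not the coboundary of a
`ρ(G)`-valued function on the vertices. -/
def IsTwistedNontrivial (η : H → G) (ρ : AddChar G ℂ) (F : Set X.Edge)
    (C : (X.delete F).ConnectedComponent) : Prop :=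
  ¬ ∃ ξ : V → G, ∀ h : H, X.edge h ∉ F → X.src h ∈ C.supp →
    ρ (η h) = ρ (ξ (X.tgt h) - ξ (X.src h))

/-- `F` is an independent set of the `ρ`-twisted matroid on `E(X)` of the cover: every connected
component of `X \ F` is nontrivial for the `ρ(G)`-cover. -/
def IsIndep (η : H → G) (ρ : AddChar G ℂ) (F : Finset X.Edge) : Prop :=
  ∀ C : (X.delete (F : Set X.Edge)).ConnectedComponent, X.IsTwistedNontrivial η ρ F C

/-- `F` is a basis of the `ρ`-twisted matroid: a maximal independent set. -/
def IsBasis (η : H → G) (ρ : AddChar G ℂ) (F : Finset X.Edge) : Prop :=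
  Maximal (X.IsIndep η ρ) F

/-- `P` runs once around a cycle of the connected component `C` of `X \ F`: a closed reduced path
in `C` that passes through pairwise distinct vertices. -/
def IsCycleOf (F : Set X.Edge) (C : (X.delete F).ConnectedComponent) (P : List H) : Prop :=
  X.IsClosedReduced P ∧ (P.map X.src).Nodup ∧ ∀ h ∈ P, X.edge h ∉ F ∧ X.src h ∈ C.supp

/-- The cycle of the connected component `C` of `X \ F`.  When `C` has genus one, it is unique up to
the starting point and the orientation. -/
def cycleOf (F : Set X.Edge) (C : (X.delete F).ConnectedComponent) : List H :=
  Classical.epsilon (X.IsCycleOf F C)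

/-- The weight `|1 - ρ(η(C))|²` of a genus one component `C` of `X \ F`, where `η(C)` is the sum of
the voltages along its cycle. Changing the starting point or the orientation of the cycle replaces
`ρ(η(C))` by itself or its complex conjugate and does not affect the weight. -/
def compWeight (η : H → G) (ρ : AddChar G ℂ) (F : Set X.Edge)
    (C : (X.delete F).ConnectedComponent) : ℝ :=
  ‖1 - ρ ((X.cycleOf F C).map η).sum‖ ^ 2

/-- The weight `w_ρ(F)` of a basis: the product of the weights of the components of `X \ F`. -/
def weight [Fintype V] (η : H → G) (ρ : AddChar G ℂ) (F : Finset X.Edge) : ℝ :=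
  ∏ C : (X.delete (F : Set X.Edge)).ConnectedComponent, X.compWeight η ρ F C

/-- The weight polynomial `∑_F w_ρ(F) ∏_{e ∈ F} x_e`, the sum being over the bases `F`. -/
def weightPolynomial [Fintype V] [Fintype H] (η : H → G) (ρ : AddChar G ℂ) :
    MvPolynomial X.Edge ℝ :=
  ∑ F : Finset X.Edge with X.IsBasis η ρ F,
    MvPolynomial.C (X.weight η ρ F) * ∏ e ∈ F, MvPolynomial.X e

end SGraph

/-- A free `G`-cover `p : X' → X`, where `G` acts on the vertices and half-edges of `X'`: `p` is a
surjective graph morphism that is a bijection on tangent spaces (local degree one at every vertex),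
`G` acts on `X'` by graph automorphisms preserving the fibers of `p`, and freely and transitively on
the vertex fibers (hence freely and transitively on the fibers over half-edges and edges). -/
structure FreeCover (G : Type*) [AddCommGroup G] {V' H' V H : Type*} [AddAction G V']
    [AddAction G H'] (X' : SGraph V' H') (X : SGraph V H) where
  onV : V' → V
  onH : H' → H
  map_root : ∀ h, onV (X'.root h) = X.root (onH h)
  map_bar : ∀ h, onH (X'.bar h) = X.bar (onH h)
  vadd_root : ∀ (g : G) (h : H'), X'.root (g +ᵥ h) = g +ᵥ X'.root h
  vadd_bar : ∀ (g : G) (h : H'), X'.bar (g +ᵥ h) = g +ᵥ X'.bar h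
  onV_vadd : ∀ (g : G) (v : V'), onV (g +ᵥ v) = onV v
  onH_vadd : ∀ (g : G) (h : H'), onH (g +ᵥ h) = onH h
  surjective : Function.Surjective onV
  local_degree_one : ∀ (v : V') (h : H), X.root h = onV v → ∃! h', X'.root h' = v ∧ onH h' = h
  transitive : ∀ v w : V', onV v = onV w → ∃ g : G, g +ᵥ v = w
  free : ∀ (g : G) (v : V'), g +ᵥ v = v → g = 0

/-- `η` is a `G`-voltage assignment of the free cover `p`, extended to both orientations of every
edge: for some choice `σ` of a base point in every vertex fiber (which identifies the fiber with
`G`), the lift of the oriented edge `h` that starts at the base point `σ (src h)` ends at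
`η h +ᵥ σ (tgt h)`. -/
def FreeCover.IsVoltage {G : Type*} [AddCommGroup G] {V' H' V H : Type*} [AddAction G V']
    [AddAction G H'] {X' : SGraph V' H'} {X : SGraph V H} (p : FreeCover G X' X)
    (η : H → G) : Prop :=
  ∃ σ : V → V', (∀ v, p.onV (σ v) = v) ∧
    ∀ h' : H', X'.src h' = σ (X.src (p.onH h')) →
      X'.tgt h' = η (p.onH h') +ᵥ σ (X.tgt (p.onH h'))

end

/-! The reciprocal of the $L$-function is a determinant. Let $W(s)$ be the matrix on half-edges with
entry $\rho(\eta(h))s^{x_h}$ at $(h,k)$ when $k$ may follow $h$. The trace of $W^k$ sums the weights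
of closed reduced paths of length $k$. Each such path is a unique power of a primitive one, and a
prime has as many starting points as its length, so exponentiating $-\log\det(1-W)=\sum_k
\mathrm{tr}(W^k)/k$ gives the Euler product when the weights are small (`hasProd_prime`). The
determinant is holomorphic on the slit plane, hence it is the continuation (`isMetricLInv_det`,
`IsMetricLInv.eqOn`).

A Bass-type formula (`det_one_sub_edgeMatrix`) turns it into $\prod_e(1-s^{2x_e})$ times a
determinant of size $|V|$. As $1-s^{2x_e}\sim-2x_e(s-1)$, the product contributes $(s-1)^{|E|}$,
while the vertex matrix has at most a simple pole at $1$, with residue $-1/2$ times the twisted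
Laplacian with edge weights $1/x_e$. Since $g-1=|E|-|V|$, the coefficient of $(s-1)^{g-1}$ is
$(-2)^{g-1}\prod_e x_e\cdot\det(\text{Laplacian})$ (`isBigO_det_one_sub_edgeMatrix`).

It remains to prove a twisted matrix-tree theorem (`prod_mul_det_laplacian`). The Laplacian is
$B^*\mathrm{diag}(1/x_e)B$ for the twisted incidence matrix $B$, and Cauchy–Binet applies. A maximal
minor of $B$ is nonzero exactly when its rows are the complement of a basis $F$
(`isBasis_iff_det_ne_zero`). Orienting $X\setminus F$ towards its cycles makes that minor block
triangular up to phases and a row permutation, with a cyclic block of determinant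
$1-\rho(\eta(X_i))$ for each component and identity blocks elsewhere (`det_flow`). Its squared
modulus is $w_\rho(F)$. -/

noncomputable section

/-! ### Determinants: eigenvalues, the logarithm of det(1 - A), Cauchy–Binet -/

namespace Matrix

open Polynomial

/-- Split `p` into linear factors: each `det (A - a)` is the characteristic polynomial at `a` up to
a sign, and that sign cancels because there are as many roots as rows. -/
theorem det_aeval_eq_prod_roots {n K : Type*} [Fintype n] [DecidableEq n] [Field K]
    [IsAlgClosed K] (A : Matrix n n K) (p : K[X]) :
    (aeval A p).det = (A.charpoly.roots.map fun r => p.eval r).prod := by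
  have hcard : A.charpoly.roots.card = Fintype.card n := by
    rw [← (IsAlgClosed.splits A.charpoly).natDegree_eq_card_roots,
      Matrix.charpoly_natDegree_eq_dim]
  have hlin : ∀ a : K, (aeval A (X - C a)).det = (A.charpoly.roots.map fun r => r - a).prod := by
    intro a
    have h1 : (aeval A (X - C a)) = -(algebraMap K (Matrix n n K) a - A) := by simp
    have h2 : (algebraMap K (Matrix n n K) a - A).det = A.charpoly.eval a := by
      rw [eval_charpoly]; rfl
    rw [h1, det_neg, h2, (IsAlgClosed.splits A.charpoly).eval_eq_prod_roots_of_monic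
      A.charpoly_monic, ← hcard]
    rw [← Multiset.card_map (fun r => a - r), ← Multiset.prod_map_neg, Multiset.map_map]
    simp
  have hp := IsAlgClosed.splits p
  rw [hp.eq_prod_roots]
  simp only [map_mul, det_mul, aeval_C, eval_mul, eval_C, Multiset.prod_map_mul,
    Multiset.map_const', Multiset.prod_replicate, hcard]
  congr 1
  · rw [algebraMap_eq_diagonal, det_diagonal]; simp
  · induction p.roots using Multiset.induction with
    | empty => simp
    | cons a s ih =>
      simp only [Multiset.map_cons, Multiset.prod_cons, map_mul, det_mul, eval_mul,
        Multiset.prod_map_mul, ih, hlin]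
      simp

/-- The eigenvalues of `A ^ k` are the `k`-th powers of those of `A` with multiplicity, seen by
applying the preceding product formula to the polynomials `C a - X ^ k`. -/
theorem trace_pow_eq_sum_roots {n K : Type*} [Fintype n] [DecidableEq n] [Field K]
    [IsAlgClosed K] (A : Matrix n n K) (k : ℕ) :
    (A ^ k).trace = (A.charpoly.roots.map (· ^ k)).sum := by
  have : (A ^ k).charpoly = ((A.charpoly.roots.map (· ^ k)).map fun r => X - C r).prod := by
    have : Infinite K := IsAlgClosed.instInfinite
    refine Polynomial.funext fun a => ?_
    have h2 : aeval A (C a - X ^ k) = algebraMap K (Matrix n n K) a - A ^ k := by simp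
    have h3 : (algebraMap K (Matrix n n K) a - A ^ k).det = (A ^ k).charpoly.eval a := by
      rw [eval_charpoly]; rfl
    rw [← h3, ← h2, det_aeval_eq_prod_roots, eval_multiset_prod]
    simp [Multiset.map_map]
  rw [trace_eq_sum_roots_charpoly, this, roots_multiset_prod_X_sub_C]

theorem det_one_sub_eq_prod_roots {n K : Type*} [Fintype n] [DecidableEq n] [Field K]
    [IsAlgClosed K] (A : Matrix n n K) :
    (1 - A).det = (A.charpoly.roots.map (1 - ·)).prod := by
  have := det_aeval_eq_prod_roots A (1 - X)
  simpa using this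

/-- The logarithm of `det (1 - A)` as a sum over traces of powers, for `A` of small norm. -/
theorem exists_hasSum_trace_pow_and_exp_eq_det {n : Type*} [Fintype n] [DecidableEq n]
    (A : Matrix n n ℂ) (hA : ∀ i, ∑ j, ‖A i j‖ < 1) :
    ∃ a, HasSum (fun k : ℕ => (A ^ (k + 1)).trace / (k + 1)) a ∧
      Complex.exp (-a) = (1 - A).det := by
  -- Compare an eigenvector equation at a coordinate of maximal modulus: row sums below 1 bound
  -- every eigenvalue.
  have hroot : ∀ r ∈ A.charpoly.roots, ‖r‖ < 1 := by
    intro r hr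
    have hr' : A.charpoly.IsRoot r := (mem_roots'.1 hr).2
    have hdet : (algebraMap ℂ (Matrix n n ℂ) r - A).det = 0 := by
      have := eval_charpoly A r
      rw [IsRoot.def] at hr'
      rw [← hr', this]; rfl
    obtain ⟨v, hv0, hv⟩ := exists_mulVec_eq_zero_iff.2 hdet
    have hv' : ∀ i, r * v i = ∑ j, A i j * v j := by
      intro i
      have := congrFun hv i
      simp only [sub_mulVec, Algebra.algebraMap_eq_smul_one, smul_mulVec, one_mulVec, Pi.sub_apply,
        Pi.smul_apply, smul_eq_mul, Pi.zero_apply, sub_eq_zero] at this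
      rw [this]; rfl
    obtain ⟨i0, hi0⟩ := Function.ne_iff.1 hv0
    have : Nonempty n := ⟨i0⟩
    obtain ⟨i, -, hi⟩ := Finset.exists_max_image Finset.univ (fun i => ‖v i‖)
      Finset.univ_nonempty
    have hpos : 0 < ‖v i‖ := lt_of_lt_of_le (norm_pos_iff.2 hi0) (hi i0 (Finset.mem_univ _))
    have : ‖r‖ * ‖v i‖ ≤ (∑ j, ‖A i j‖) * ‖v i‖ := by
      rw [← norm_mul, hv' i, Finset.sum_mul]
      refine (norm_sum_le _ _).trans (Finset.sum_le_sum fun j _ => ?_)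
      rw [norm_mul]
      exact mul_le_mul_of_nonneg_left (hi j (Finset.mem_univ _)) (norm_nonneg _)
    exact (le_of_mul_le_mul_right this hpos).trans_lt (hA i)
  rw [det_one_sub_eq_prod_roots]
  simp only [trace_pow_eq_sum_roots]
  -- Each eigenvalue contributes its own series for `-log (1 - r)`; only the exponential of the
  -- total is claimed, so no branch of the logarithm of the product is needed.
  generalize A.charpoly.roots = s at hroot ⊢
  induction s using Multiset.induction with
  | empty => exact ⟨0, by simp⟩
  | cons r s ih =>
    obtain ⟨a, ha, ha'⟩ := ih fun r hr => hroot r (Multiset.mem_cons_of_mem hr)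
    have hr := hroot r (Multiset.mem_cons_self _ _)
    refine ⟨-Complex.log (1 - r) + a, ?_, ?_⟩
    · simp only [Multiset.map_cons, Multiset.sum_cons, add_div]
      exact (Complex.hasSum_taylorSeries_neg_log' hr).add ha
    · rw [neg_add, neg_neg, Complex.exp_add, Complex.exp_log, ha']
      · simp
      · intro h
        rw [sub_eq_zero] at h
        rw [← h] at hr
        simp at hr

/-- The Cauchy–Binet formula. -/
theorem det_mul_eq_sum_powersetCard {n E R : Type*} [Fintype n] [DecidableEq n] [Fintype E]
    [DecidableEq E] [CommRing R] (M : Matrix n E R) (N : Matrix E n R) (D : Finset E → R)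
    (hD : ∀ f : n → E, Function.Injective f →
      (M.submatrix id f).det * (N.submatrix f id).det = D (Finset.univ.image f)) :
    (M * N).det = ∑ A ∈ Finset.powersetCard (Fintype.card n) Finset.univ, D A := by
  -- Row expansion by multilinearity. The function `D` records that a product of complementary
  -- minors depends only on the image of `f`, which avoids ordering `E`.
  have h1 : (M * N).det = ∑ g : n → E, (∏ i, M i (g i)) * (N.submatrix g id).det := by
    have e : M * N = fun i => ∑ j, M i j • N j := by
      ext i k
      simp [Matrix.mul_apply, Finset.sum_apply]
    have := (detRowAlternating (n := n) (R := R)).toMultilinearMap.map_sum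
      (fun i j => M i j • N j)
    change det _ = _ at this
    rw [e, this]
    refine Finset.sum_congr rfl fun g _ => ?_
    exact (detRowAlternating (n := n) (R := R)).toMultilinearMap.map_smul_univ
      (fun i => M i (g i)) (fun i => N (g i))
  have h2 : (M * N).det = ∑ g : n → E with Function.Injective g,
      (∏ i, M i (g i)) * (N.submatrix g id).det := by
    rw [h1]
    symm
    apply Finset.sum_subset (Finset.subset_univ _)
    intro g _ hg
    obtain ⟨i, j, hij, hne⟩ : ∃ i j, g i = g j ∧ i ≠ j := by
      by_contra! hcon
      exact hg (Finset.mem_filter.2 ⟨Finset.mem_univ _, fun i j h => hcon i j h⟩)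
    rw [det_zero_of_row_eq hne, mul_zero]
    ext k
    simp [hij]
  rw [h2, ← Finset.sum_fiberwise_of_maps_to (t := Finset.powersetCard (Fintype.card n) Finset.univ)
    (g := fun g : n → E => Finset.univ.image g)]
  · refine Finset.sum_congr rfl fun A hA => ?_
    rw [Finset.mem_powersetCard_univ] at hA
    obtain ⟨e⟩ : Nonempty (n ≃ A) := Fintype.card_eq.1 (by simp [hA])
    set f : n → E := fun i => e i with hf
    have hinj : Function.Injective f := fun i j h => e.injective (Subtype.ext h)
    have him : Finset.univ.image f = A := by
      ext a
      simp only [hf, Finset.mem_image, Finset.mem_univ, true_and]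
      exact ⟨by rintro ⟨i, rfl⟩; exact (e i).2, fun ha => ⟨e.symm ⟨a, ha⟩, by simp⟩⟩
    have hDA := hD f hinj
    rw [him] at hDA
    rw [← hDA, det_apply', Finset.sum_mul]
    symm
    -- The injections with image `A` are the rearrangements of `f`; the signs from permuting the
    -- rows of `N` rebuild the Leibniz sum of the minor of `M`.
    refine Finset.sum_bij (fun σ _ => f ∘ (σ⁻¹ : Equiv.Perm n)) ?_ ?_ ?_ ?_
    · intro σ _
      simp only [Finset.mem_filter, Finset.mem_univ, true_and]
      refine ⟨hinj.comp (σ⁻¹ : Equiv.Perm n).injective, ?_⟩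
      rw [← Finset.image_image, Finset.image_univ_equiv, him]
    · intro σ _ τ _ h
      have : (σ⁻¹ : Equiv.Perm n) = τ⁻¹ := Equiv.ext fun i => hinj (congrFun h i)
      exact inv_injective this
    · intro g hg
      simp only [Finset.mem_filter, Finset.mem_univ, true_and] at hg
      obtain ⟨hg, hgA⟩ := hg
      have : ∀ i, ∃ j, f j = g i := by
        intro i
        have : g i ∈ Finset.univ.image f := by
          rw [him, ← hgA]; exact Finset.mem_image_of_mem _ (Finset.mem_univ _)
        simpa using this
      choose τ hτ using this
      have hτi : Function.Injective τ := fun i j h => hg (by rw [← hτ, ← hτ, h])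
      refine ⟨(Equiv.ofBijective τ (Finite.injective_iff_bijective.1 hτi))⁻¹,
        Finset.mem_univ _, ?_⟩
      ext i
      simp [hτ]
    · intro σ _
      have hN : N.submatrix (f ∘ (σ⁻¹ : Equiv.Perm n)) id
          = (N.submatrix f id).submatrix (σ⁻¹ : Equiv.Perm n) id := rfl
      rw [hN, det_permute, mul_left_comm, ← mul_assoc, Equiv.Perm.sign_inv]
      congr 2
      rw [← Equiv.prod_comp σ (fun i => M i ((f ∘ (σ⁻¹ : Equiv.Perm n)) i))]
      simp
  · intro g hg
    simp only [Finset.mem_filter, Finset.mem_univ, true_and] at hg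
    rw [Finset.mem_powersetCard_univ, Finset.card_image_of_injective _ hg, Finset.card_univ]

end Matrix

/-! ### Words: rotations, periods and powers -/

namespace List

variable {α : Type*}

/-- Rotation of a list by one letter. -/
def rotateOne (l : List α) : List α := l.rotate 1

theorem iterate_rotateOne (n : ℕ) (l : List α) : rotateOne^[n] l = l.rotate n := by
  induction n generalizing l with
  | zero => simp
  | succ n ih =>
    rw [Function.iterate_succ_apply', ih, rotateOne, rotate_rotate]

/-- The smallest positive `d` such that rotation by `d` letters fixes the list. -/
def rotationPeriod (l : List α) : ℕ := Function.minimalPeriod rotateOne l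

theorem isPeriodicPt_rotateOne_iff {l : List α} {d : ℕ} :
    Function.IsPeriodicPt rotateOne d l ↔ l.rotate d = l := by
  rw [Function.IsPeriodicPt, Function.IsFixedPt, iterate_rotateOne]

theorem rotationPeriod_dvd_iff {l : List α} {d : ℕ} :
    l.rotationPeriod ∣ d ↔ l.rotate d = l := by
  rw [← isPeriodicPt_rotateOne_iff, Function.isPeriodicPt_iff_minimalPeriod_dvd, rotationPeriod]

theorem rotationPeriod_dvd_length (l : List α) : l.rotationPeriod ∣ l.length := by
  rw [rotationPeriod_dvd_iff, rotate_length]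

theorem rotationPeriod_pos {l : List α} (hl : l ≠ []) : 0 < l.rotationPeriod :=
  Nat.pos_of_dvd_of_pos l.rotationPeriod_dvd_length (length_pos_iff.2 hl)

theorem rotationPeriod_rotate {l : List α} (hl : l ≠ []) (n : ℕ) :
    (l.rotate n).rotationPeriod = l.rotationPeriod := by
  rw [rotationPeriod, ← iterate_rotateOne, Function.minimalPeriod_apply_iterate, rotationPeriod]
  exact Function.minimalPeriod_pos_iff_mem_periodicPts.1 (rotationPeriod_pos hl)

/-- The `n`-fold concatenation `u ⋯ u`. -/
def power (u : List α) (n : ℕ) : List α := (replicate n u).flatten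

theorem power_zero (u : List α) : u.power 0 = [] := rfl

theorem power_succ (u : List α) (n : ℕ) : u.power (n + 1) = u ++ u.power n := by
  simp [power, replicate_succ]

theorem power_one (u : List α) : u.power 1 = u := by
  simp [power]

theorem append_power_comm (u : List α) (n : ℕ) : u ++ u.power n = u.power n ++ u := by
  induction n with
  | zero => simp [power_zero]
  | succ n ih => rw [power_succ, append_assoc, ih]

theorem length_power (u : List α) (n : ℕ) : (u.power n).length = n * u.length := by
  induction n with
  | zero => simp [power_zero]
  | succ n ih => rw [power_succ, length_append, ih]; ring

theorem power_mul (u : List α) (m n : ℕ) : u.power (m * n) = (u.power m).power n := by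
  induction n with
  | zero => simp [power_zero]
  | succ n ih =>
    rw [power_succ, ← ih, Nat.mul_succ, Nat.add_comm]
    simp only [power]
    rw [replicate_add, flatten_append]

theorem rotate_power (u : List α) (n : ℕ) : (u.power n).rotate u.length = u.power n := by
  cases n with
  | zero => simp [power_zero]
  | succ n => rw [power_succ, rotate_append_length_eq, append_power_comm]

theorem eq_power_of_append_comm {u v : List α} (n : ℕ) (h : u ++ v = v ++ u)
    (hl : v.length = n * u.length) : v = u.power n := by
  induction n generalizing v with
  | zero => simpa [power_zero] using hl
  | succ n ih =>
    have hpre : u <+: v := by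
      have h1 : u <+: v ++ u := ⟨v, h⟩
      exact prefix_of_prefix_length_le h1 (prefix_append v u) (by rw [hl]; nlinarith)
    obtain ⟨v', rfl⟩ := hpre
    rw [power_succ, ← ih (v := v')]
    · rw [append_assoc] at h
      exact append_cancel_left h
    · rw [length_append] at hl
      linarith

/-- Invariance under rotation by `d` says that the prefix of length `d` commutes with the whole
word, which forces the word to be a power of it. -/
theorem eq_power_take {l : List α} {d : ℕ} (hd : d ∣ l.length) (h : l.rotate d = l) :
    l = (l.take d).power (l.length / d) := by
  rcases eq_or_ne l [] with rfl | hl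
  · simp [power_zero]
  have hle : d ≤ l.length := Nat.le_of_dvd (length_pos_iff.2 hl) hd
  obtain ⟨n, hn⟩ := hd
  have hd0 : 0 < d := by
    rcases Nat.eq_zero_or_pos d with rfl | h0
    · simp at hn; exact absurd hn hl
    · exact h0
  have hlen : (l.take d).length = d := by simp [hle]
  have hn' : l.length / d = n := by rw [hn, Nat.mul_div_cancel_left _ hd0]
  apply eq_power_of_append_comm
  · have h1 : l.drop d ++ l.take d = l := by rw [← rotate_eq_drop_append_take hle, h]
    have h2 : l.take d ++ l.drop d = l := take_append_drop d l
    calc l.take d ++ l = l.take d ++ (l.drop d ++ l.take d) := by rw [h1]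
      _ = l ++ l.take d := by rw [← append_assoc, h2]
  · rw [hlen, hn', hn, Nat.mul_comm]

/-- A power of `Q` is fixed by rotation by the length of `Q`; conversely, a word is a power of its
prefix of period length. This makes primitivity a statement about periods. -/
theorem rotationPeriod_eq_length_iff {l : List α} (hl : l ≠ []) :
    l.rotationPeriod = l.length ↔
      ∀ (Q : List α) (c : ℕ), 2 ≤ c → l ≠ (replicate c Q).flatten := by
  constructor
  · rintro h Q c hc rfl
    change (Q.power c).rotationPeriod = (Q.power c).length at h
    have h1 : (Q.power c).rotationPeriod ∣ Q.length := rotationPeriod_dvd_iff.2 (rotate_power Q c)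
    have hQ : 0 < Q.length := by
      rcases Nat.eq_zero_or_pos Q.length with h0 | h0
      · exfalso
        apply hl
        rw [← length_eq_zero_iff]
        change (Q.power c).length = 0
        rw [length_power, h0, Nat.mul_zero]
      · exact h0
    have h2 := Nat.le_of_dvd hQ h1
    rw [h, length_power] at h2
    nlinarith
  · intro h
    by_contra hne
    have hd := l.rotationPeriod_dvd_length
    have hpos := rotationPeriod_pos hl
    refine h (l.take l.rotationPeriod) (l.length / l.rotationPeriod) ?_
      (eq_power_take hd (rotationPeriod_dvd_iff.1 dvd_rfl))
    obtain ⟨n, hn⟩ := hd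
    rw [hn, Nat.mul_div_cancel_left _ hpos]
    have : n ≠ 0 := by
      rintro rfl
      exact hl (length_eq_zero_iff.1 (by rw [hn, Nat.mul_zero]))
    have : n ≠ 1 := by
      rintro rfl
      exact hne (by rw [hn, Nat.mul_one])
    omega

/-- The period divides the length of `u`; were it smaller, `u` would itself be a proper power of a
shorter prefix. -/
theorem rotationPeriod_power {u : List α} (hu : u ≠ []) (h : u.rotationPeriod = u.length) (n : ℕ) :
    (u.power (n + 1)).rotationPeriod = u.length := by
  set L := u.power (n + 1) with hL
  have hdvd : L.rotationPeriod ∣ u.length := rotationPeriod_dvd_iff.2 (rotate_power u _)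
  have hL0 : L ≠ [] := by
    rw [hL, power_succ]
    simp [hu]
  have hpos := rotationPeriod_pos hL0
  have hle := Nat.le_of_dvd (length_pos_iff.2 hu) hdvd
  have h1 := eq_power_take L.rotationPeriod_dvd_length (rotationPeriod_dvd_iff.1 dvd_rfl)
  have hLlen : L.length = (n + 1) * u.length := length_power u _
  obtain ⟨q, hq⟩ := hdvd
  have hq0 : q ≠ 0 := by
    rintro rfl
    exact hu (length_eq_zero_iff.1 (by rw [hq, Nat.mul_zero]))
  have hLq : L.length / L.rotationPeriod = q * (n + 1) := by
    rw [hLlen, hq]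
    rw [show (n + 1) * (L.rotationPeriod * q) = L.rotationPeriod * (q * (n + 1)) by ring,
      Nat.mul_div_cancel_left _ hpos]
  rw [hLq, power_mul] at h1
  have h2 : u = (L.take L.rotationPeriod).power q := by
    have hlen : ((L.take L.rotationPeriod).power q).length = u.length := by
      rw [length_power, length_take, min_eq_left, hq, Nat.mul_comm]
      rw [hLlen]; nlinarith
    have h3 : u ++ u.power n = (L.take L.rotationPeriod).power q ++
        ((L.take L.rotationPeriod).power q).power n := by
      rw [← power_succ, ← power_succ, ← h1]
    exact (append_inj h3 hlen.symm).1
  by_contra hne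
  refine (rotationPeriod_eq_length_iff hu).1 h _ q ?_ h2
  have : q ≠ 1 := by
    rintro rfl
    exact hne (by rw [hq, Nat.mul_one])
  omega

/-- The appended `a` encodes the wrap-around condition, and every junction between two consecutive
copies is that same condition. -/
theorem isChain_power_append {r : α → α → Prop} (a : α) (l : List α) (n : ℕ) :
    IsChain r ((a :: l).power (n + 1) ++ [a]) ↔ IsChain r ((a :: l) ++ [a]) := by
  induction n with
  | zero => rw [power_one]
  | succ n ih =>
    rw [power_succ, power_succ]
    have : (a :: l) ++ ((a :: l) ++ (a :: l).power n) ++ [a]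
        = (a :: l) ++ (a :: (l ++ (a :: l).power n ++ [a])) := by simp
    rw [this, isChain_split]
    have h2 : a :: (l ++ (a :: l).power n ++ [a]) = (a :: l).power (n + 1) ++ [a] := by
      rw [power_succ]; simp
    rw [h2, ih, and_self_iff]

end List

theorem Cycle.chain_coe_power {α : Type*} {r : α → α → Prop} (u : List α) (n : ℕ) :
    Cycle.Chain r (u.power (n + 1) : Cycle α) ↔ Cycle.Chain r (u : Cycle α) := by
  cases u with
  | nil =>
    have : ([] : List α).power (n + 1) = [] := by
      rw [← List.length_eq_zero_iff, List.length_power]; simp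
    rw [this]
  | cons a l =>
    have := List.isChain_power_append (r := r) a l n
    rw [List.power_succ, List.cons_append, Cycle.chain_coe_cons, Cycle.chain_coe_cons]
    rw [List.power_succ] at this
    simpa using this

/-! ### Traces of powers as sums over closed chains -/

namespace Matrix

/-- A step is weighted by its starting letter, so the end `b` carries no weight, and setting `b = a`
counts each letter of a closed chain once. -/
theorem pow_succ_apply_eq_sum_isChain {H R : Type*} [Fintype H] [DecidableEq H] [CommRing R]
    (r : H → H → Prop) (c : H → R) (k : ℕ) (a b : H) :
    ((Matrix.of fun h h' => if r h h' then c h else 0 : Matrix H H R) ^ (k + 1)) a b =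
      ∑ g : Fin k → H, if List.IsChain r (a :: (List.ofFn g ++ [b])) then
        c a * ((List.ofFn g).map c).prod else 0 := by
  induction k generalizing a with
  | zero => simp
  | succ k ih =>
    rw [pow_succ', mul_apply, ← Equiv.sum_comp (Fin.consEquiv fun _ => H), Fintype.sum_prod_type]
    refine Finset.sum_congr rfl fun x _ => ?_
    rw [ih, Finset.mul_sum]
    refine Finset.sum_congr rfl fun g _ => ?_
    simp only [Fin.consEquiv, Equiv.coe_fn_mk, List.ofFn_cons, List.cons_append, of_apply,
      List.isChain_cons_cons (a := a), List.map_cons, List.prod_cons]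
    by_cases h : r a x <;> simp [h]

theorem trace_pow_succ_eq_sum_chain {H R : Type*} [Fintype H] [DecidableEq H] [CommRing R]
    (r : H → H → Prop) (c : H → R) (k : ℕ) :
    ((Matrix.of fun h h' => if r h h' then c h else 0 : Matrix H H R) ^ (k + 1)).trace =
      ∑ g : Fin (k + 1) → H, if Cycle.Chain r (List.ofFn g : Cycle H) then
        ((List.ofFn g).map c).prod else 0 := by
  rw [trace, ← Equiv.sum_comp (Fin.consEquiv fun _ => H), Fintype.sum_prod_type]
  refine Finset.sum_congr rfl fun a _ => ?_
  rw [diag_apply, pow_succ_apply_eq_sum_isChain]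
  refine Finset.sum_congr rfl fun g _ => ?_
  simp [Fin.consEquiv, Cycle.chain_coe_cons]

end Matrix

/-! ### The Euler product as the inverse of a determinant -/

namespace SGraph

variable {V H : Type*} (X : SGraph V H)

/-- The weighted non-backtracking matrix. -/
def edgeMatrix (c : H → ℂ) : Matrix H H ℂ :=
  Matrix.of fun h h' => if X.Follows h h' then c h else 0

variable {X} in
theorem IsClosedReduced.rotate {P : List H} (hP : X.IsClosedReduced P) (n : ℕ) :
    X.IsClosedReduced (P.rotate n) := by
  refine ⟨fun h => hP.1 (List.rotate_eq_nil_iff.1 h), ?_⟩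
  have : (P.rotate n : Cycle H) = (P : Cycle H) := Cycle.coe_eq_coe.2 (List.IsRotated.symm ⟨n, rfl⟩)
  rw [this]
  exact hP.2

theorem isPrimitive_iff {P : List H} :
    X.IsPrimitive P ↔ X.IsClosedReduced P ∧ P.rotationPeriod = P.length := by
  refine and_congr_right fun h => (List.rotationPeriod_eq_length_iff h.1).symm

variable {X} in
theorem IsPrimitive.rotate {P : List H} (hP : X.IsPrimitive P) (n : ℕ) :
    X.IsPrimitive (P.rotate n) := by
  rw [isPrimitive_iff] at hP ⊢
  exact ⟨hP.1.rotate n, by rw [List.rotationPeriod_rotate hP.1.1, hP.2, List.length_rotate]⟩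

theorem isClosedReduced_power_iff {P : List H} (n : ℕ) :
    X.IsClosedReduced (P.power (n + 1)) ↔ X.IsClosedReduced P := by
  rw [IsClosedReduced, IsClosedReduced, Cycle.chain_coe_power]
  refine and_congr_left fun _ => not_congr ?_
  rw [← List.length_eq_zero_iff, ← List.length_eq_zero_iff, List.length_power]
  simp

/-- The `(m + 1)`-fold power of a primitive path. -/
def primitivePower (q : {Q : List H // X.IsPrimitive Q} × ℕ) : List H := q.1.1.power (q.2 + 1)

/-- The length of the primitive root is recovered as the rotation period of the power, hence so are
the root and the exponent. -/
theorem primitivePower_injective : Function.Injective X.primitivePower := by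
  rintro ⟨⟨P, hP⟩, m⟩ ⟨⟨Q, hQ⟩, n⟩ h
  simp only [primitivePower] at h
  have hP' := X.isPrimitive_iff.1 hP
  have hQ' := X.isPrimitive_iff.1 hQ
  have h1 := List.rotationPeriod_power hP'.1.1 hP'.2 m
  have h2 := List.rotationPeriod_power hQ'.1.1 hQ'.2 n
  have hlen : P.length = Q.length := by rw [← h1, ← h2, h]
  have hPQ : P = Q := by
    rw [List.power_succ, List.power_succ] at h
    exact (List.append_inj h hlen).1
  subst hPQ
  have h3 := congrArg List.length h
  rw [List.length_power, List.length_power] at h3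
  have h4 : m + 1 = n + 1 := Nat.eq_of_mul_eq_mul_right (List.length_pos_iff.2 hP'.1.1) h3
  simp only [Prod.mk.injEq, true_and]
  omega

theorem mem_range_primitivePower {L : List H} (hL : X.IsClosedReduced L) :
    L ∈ Set.range X.primitivePower := by
  have hd := L.rotationPeriod_dvd_length
  have hpos := List.rotationPeriod_pos hL.1
  have h1 := List.eq_power_take hd (List.rotationPeriod_dvd_iff.1 dvd_rfl)
  obtain ⟨m, hm⟩ : ∃ m, L.length / L.rotationPeriod = m + 1 := by
    refine Nat.exists_eq_succ_of_ne_zero (Nat.div_pos (Nat.le_of_dvd ?_ hd) hpos).ne'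
    exact List.length_pos_iff.2 hL.1
  rw [hm] at h1
  set Q := L.take L.rotationPeriod with hQ
  have hQc : X.IsClosedReduced Q := by rwa [h1, isClosedReduced_power_iff] at hL
  have hQlen : Q.length = L.rotationPeriod := by
    rw [hQ, List.length_take, min_eq_left (Nat.le_of_dvd (List.length_pos_iff.2 hL.1) hd)]
  have hQp : X.IsPrimitive Q := by
    refine ⟨hQc, fun R c hc hR => ?_⟩
    change Q = R.power c at hR
    have h2 : L = R.power (c * (m + 1)) := by rw [List.power_mul, ← hR, ← h1]
    have h3 : L.rotationPeriod ∣ R.length := by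
      rw [List.rotationPeriod_dvd_iff, h2, List.rotate_power]
    have h4 : Q.length = c * R.length := by
      conv_lhs => rw [hR]
      exact List.length_power _ _
    have hR0 : 0 < R.length := by
      rcases Nat.eq_zero_or_pos R.length with h0 | h0
      · rw [h0, Nat.mul_zero, hQlen] at h4
        omega
      · exact h0
    have h5 := Nat.le_of_dvd hR0 h3
    rw [← hQlen, h4] at h5
    nlinarith
  exact ⟨(⟨Q, hQp⟩, m), h1.symm⟩

/-- The prime represented by a primitive path. -/
def primeOf (Q : {Q : List H // X.IsPrimitive Q}) : X.Prime := ⟨(Q.1 : Cycle H), Q.1, Q.2, rfl⟩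

/-- A primitive path has full rotation period, so its rotations by fewer letters than its length are
distinct and exhaust its prime. -/
theorem exists_equiv_fiber_primeOf (P : X.Prime) :
    ∃ Q : {Q : List H // X.IsPrimitive Q}, X.primeOf Q = P ∧
      Nonempty (Fin Q.1.length ≃ {R : {Q : List H // X.IsPrimitive Q} // X.primeOf R = P}) := by
  obtain ⟨_, Q, hQ, rfl⟩ := P
  refine ⟨⟨Q, hQ⟩, rfl, ⟨Equiv.ofBijective
    (fun i => ⟨⟨Q.rotate i, hQ.rotate i⟩, ?_⟩) ⟨?_, ?_⟩⟩⟩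
  · exact Subtype.ext (Cycle.coe_eq_coe.2 (List.IsRotated.symm ⟨i, rfl⟩))
  · intro i j hij
    have h1 : Q.rotate i = Q.rotate j := congrArg (fun R => R.1.1) hij
    rw [← List.iterate_rotateOne, ← List.iterate_rotateOne] at h1
    have hp := (X.isPrimitive_iff.1 hQ).2
    refine Fin.ext (Function.iterate_injOn_Iio_minimalPeriod (f := List.rotateOne) (x := Q) ?_ ?_ h1)
    · exact lt_of_lt_of_eq i.2 hp.symm
    · exact lt_of_lt_of_eq j.2 hp.symm
  · rintro ⟨⟨R, hR⟩, hRP⟩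
    have h1 : (R : Cycle H) = (Q : Cycle H) := congrArg Subtype.val hRP
    obtain ⟨n, hn⟩ := (Cycle.coe_eq_coe.1 h1).symm
    have hpos := List.length_pos_iff.2 hQ.1.1
    refine ⟨⟨n % Q.length, Nat.mod_lt _ hpos⟩, ?_⟩
    refine Subtype.ext (Subtype.ext ?_)
    exact (List.rotate_mod _ _).trans hn

theorem summable_prod_map_list [Fintype H] (c : H → ℝ) (h0 : ∀ h, 0 ≤ c h) (hc : ∑ h, c h < 1) :
    Summable fun L : List H => (L.map c).prod := by
  rw [← List.equivSigmaTuple.symm.summable_iff]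
  have hfin : ∀ n : ℕ, ∑ g : Fin n → H, ((List.ofFn g).map c).prod = (∑ h, c h) ^ n := by
    intro n
    rw [Fintype.sum_pow]
    refine Finset.sum_congr rfl fun g _ => ?_
    rw [List.map_ofFn, List.prod_ofFn]
    rfl
  rw [summable_sigma_of_nonneg]
  · refine ⟨fun n => (hasSum_fintype _).summable, ?_⟩
    simp only [tsum_fintype]
    refine (summable_geometric_of_lt_one (Finset.sum_nonneg fun h _ => h0 h) hc).congr fun n => ?_
    exact (hfin n).symm
  · rintro ⟨n, g⟩
    refine List.prod_nonneg fun x hx => ?_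
    obtain ⟨h, -, rfl⟩ := List.mem_map.1 hx
    exact h0 h

/-- The Euler product over primes with small weights. -/
theorem hasProd_prime [Fintype H] (c : H → ℂ) (hc : ∀ h, Fintype.card H * ‖c h‖ < 1) :
    (1 - X.edgeMatrix c).det ≠ 0 ∧
    HasProd (fun P : X.Prime => (1 - (P.1.toMultiset.map c).prod)⁻¹)
      ((1 - X.edgeMatrix c).det)⁻¹ := by
  -- This gives absolute convergence over all words; the same hypothesis bounds the row sums of the
  -- edge matrix.
  have hsum : ∑ h, ‖c h‖ < 1 := by
    rcases isEmpty_or_nonempty H with hH | hH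
    · simp
    · have hcard : (0 : ℝ) < Fintype.card H := by exact_mod_cast Fintype.card_pos
      have h1 : ∑ h, (Fintype.card H : ℝ) * ‖c h‖ < ∑ _h : H, (1 : ℝ) :=
        Finset.sum_lt_sum_of_nonempty Finset.univ_nonempty fun h _ => hc h
      rw [← Finset.mul_sum] at h1
      simp only [Finset.sum_const, Finset.card_univ, nsmul_eq_mul, mul_one] at h1
      nlinarith
  have hc1 : ∀ h, ‖c h‖ < 1 := fun h =>
    (Finset.single_le_sum (f := fun h => ‖c h‖) (fun h _ => norm_nonneg _)
      (Finset.mem_univ h)).trans_lt hsum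
  obtain ⟨a, ha, hdet⟩ := Matrix.exists_hasSum_trace_pow_and_exp_eq_det (X.edgeMatrix c) (by
    intro i
    refine lt_of_le_of_lt ?_ (hc i)
    rw [← nsmul_eq_mul, ← Finset.card_univ]
    refine Finset.sum_le_card_nsmul _ _ _ fun j _ => ?_
    rw [edgeMatrix, Matrix.of_apply]
    split_ifs <;> simp)
  have hdet0 : (1 - X.edgeMatrix c).det ≠ 0 := by rw [← hdet]; exact Complex.exp_ne_zero _
  refine ⟨hdet0, ?_⟩
  set wt : List H → ℂ := fun L => (L.map c).prod with hwt
  -- Dividing by the length matches the factor `1 / (k + 1)` in the trace expansion.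
  set f : List H → ℂ := fun L => if X.IsClosedReduced L then wt L / L.length else 0 with hf
  have hwtnorm : ∀ L, ‖wt L‖ = (L.map fun h => ‖c h‖).prod := by
    intro L
    induction L with
    | nil => simp [hwt]
    | cons h L ih => simpa [hwt] using Or.inl ih
  have hwt1 : ∀ L, L ≠ [] → ‖wt L‖ < 1 := by
    have hle : ∀ L, ‖wt L‖ ≤ 1 := by
      intro L
      induction L with
      | nil => simp [hwt]
      | cons h L ih =>
        have : wt (h :: L) = c h * wt L := by simp [hwt]
        rw [this, norm_mul]
        exact mul_le_one₀ (hc1 h).le (norm_nonneg _) ih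
    intro L hL
    cases L with
    | nil => exact absurd rfl hL
    | cons h L =>
      have : wt (h :: L) = c h * wt L := by simp [hwt]
      rw [this, norm_mul]
      nlinarith [hc1 h, hle L, norm_nonneg (c h), norm_nonneg (wt L)]
  have hfs : Summable f := by
    refine Summable.of_norm_bounded (summable_prod_map_list (fun h => ‖c h‖)
      (fun h => norm_nonneg _) hsum) fun L => ?_
    rw [← hwtnorm, hf]
    simp only
    split_ifs with h
    · rw [norm_div, RCLike.norm_natCast]
      refine div_le_self (norm_nonneg _) ?_
      exact_mod_cast List.length_pos_iff.2 h.1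
    · simp
  have hfa : HasSum f a := by
    have h1 := hfs.hasSum
    rw [← List.equivSigmaTuple.symm.hasSum_iff] at h1
    have h2 := h1.sigma (g := fun n => ∑ g : Fin n → H, f (List.ofFn g))
      fun n => hasSum_fintype _
    rw [← hasSum_nat_add_iff' 1] at h2
    have h3 : ∑ g : Fin 0 → H, f (List.ofFn g) = 0 := by
      simp [hf, IsClosedReduced]
    rw [Finset.sum_range_one, h3, sub_zero] at h2
    have h4 := h2.unique (ha.congr_fun ?_)
    · rw [← h4]; exact hfs.hasSum
    · intro k
      rw [edgeMatrix, Matrix.trace_pow_succ_eq_sum_chain, Finset.sum_div]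
      refine Finset.sum_congr rfl fun g _ => ?_
      have : List.ofFn g ≠ [] := by simp
      simp only [hf, IsClosedReduced, ne_eq, this, not_false_eq_true, true_and, List.length_ofFn,
        ite_div, zero_div, hwt]
      push_cast
      rfl
  -- The length of the `(m + 1)`-st power of `Q` is `m + 1` times that of `Q`, so summing over
  -- powers gives a logarithm divided by the length of `Q`.
  have hprim : HasSum (fun Q : {Q : List H // X.IsPrimitive Q} =>
      -Complex.log (1 - wt Q.1) / Q.1.length) a := by
    have h1 : HasSum (f ∘ X.primitivePower) a := by
      rw [X.primitivePower_injective.hasSum_iff]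
      · exact hfa
      · intro L hL
        have : ¬ X.IsClosedReduced L := fun h => hL (X.mem_range_primitivePower h)
        simp [hf, this]
    refine h1.prod_fiberwise fun Q => ?_
    refine ((Complex.hasSum_taylorSeries_neg_log' (hwt1 Q.1 Q.2.1.1)).div_const
      (Q.1.length : ℂ)).congr_fun fun m => ?_
    have hw : wt (Q.1.power (m + 1)) = wt Q.1 ^ (m + 1) := by
      generalize m + 1 = n
      induction n with
      | zero => simp [List.power_zero, hwt]
      | succ n ih =>
        rw [List.power_succ, pow_succ', ← ih]
        simp [hwt]
    simp only [Function.comp_apply, hf, primitivePower, (X.isClosedReduced_power_iff m).2 Q.2.1,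
      if_true, hw, List.length_power]
    push_cast
    rw [div_div]
  -- The remaining denominator is cancelled by the number of rotations in the fiber of each prime.
  have hprime : HasSum (fun P : X.Prime => -Complex.log (1 - (P.1.toMultiset.map c).prod)) a := by
    have h1 := hprim
    rw [← (Equiv.sigmaFiberEquiv X.primeOf).hasSum_iff] at h1
    refine h1.sigma fun P => ?_
    obtain ⟨Q, hQ, ⟨e⟩⟩ := X.exists_equiv_fiber_primeOf P
    rw [← e.hasSum_iff]
    have hconst : ∀ R : {R : {Q : List H // X.IsPrimitive Q} // X.primeOf R = P},
        wt R.1.1 = (P.1.toMultiset.map c).prod ∧ R.1.1.length = Q.1.length := by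
      rintro ⟨R, rfl⟩
      refine ⟨by simp [primeOf, hwt], ?_⟩
      have h2 : (Q.1 : Cycle H) = (R.1 : Cycle H) := congrArg Subtype.val hQ
      exact (Cycle.coe_eq_coe.1 h2).perm.length_eq.symm
    have hlen : (Q.1.length : ℂ) ≠ 0 := by
      exact_mod_cast (List.length_pos_iff.2 Q.2.1.1).ne'
    have h3 := hasSum_fintype (fun _ : Fin Q.1.length =>
      -Complex.log (1 - (P.1.toMultiset.map c).prod) / (Q.1.length : ℂ))
    rw [Finset.sum_const, Finset.card_univ, Fintype.card_fin, nsmul_eq_mul,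
      mul_div_cancel₀ _ hlen] at h3
    refine h3.congr_fun fun i => ?_
    obtain ⟨e1, e2⟩ := hconst (e i)
    simp only [Function.comp_apply, Equiv.sigmaFiberEquiv_apply, e1, e2]
  have hfinal := hprime.cexp
  have ha' : Complex.exp a = ((1 - X.edgeMatrix c).det)⁻¹ := by
    rw [← hdet, Complex.exp_neg, inv_inv]
  rw [ha'] at hfinal
  refine hfinal.congr_fun fun P => ?_
  obtain ⟨_, Q, hQ, rfl⟩ := P
  have hw := hwt1 Q hQ.1.1
  change (1 - wt Q)⁻¹ = Complex.exp (-Complex.log (1 - wt Q))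
  rw [Complex.exp_neg, Complex.exp_log]
  intro h
  rw [sub_eq_zero] at h
  rw [← h] at hw
  simp at hw

end SGraph

/-! ### Bass-type determinant formula and expansion at s = 1 -/

namespace SGraph

variable {V H : Type*} (X : SGraph V H)

theorem edge_bar (h : H) : X.edge (X.bar h) = X.edge h :=
  Quotient.sound (Or.inr (X.bar_bar h).symm)

theorem edge_eq_edge_iff {h k : H} : X.edge h = X.edge k ↔ k = h ∨ k = X.bar h :=
  Quotient.eq (r := X.edgeSetoid)

/-- A chosen orientation of an edge. -/
def orient (e : X.Edge) : H := Quotient.out e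

@[simp] theorem edge_orient (e : X.Edge) : X.edge (X.orient e) = e := Quotient.out_eq e

theorem eq_orient_or (h : H) : h = X.orient (X.edge h) ∨ h = X.bar (X.orient (X.edge h)) :=
  X.edge_eq_edge_iff.1 (X.edge_orient (X.edge h))

/-- Half-edges are edges with a choice of one of two orientations. -/
def orientEquiv : Fin 2 × X.Edge ≃ H :=
  Equiv.ofBijective (fun p => if p.1 = 0 then X.orient p.2 else X.bar (X.orient p.2)) (by
    constructor
    · rintro ⟨i, e⟩ ⟨j, e'⟩ h
      have he : e = e' := by
        have := congrArg X.edge h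
        simp only at this
        split_ifs at this <;> simpa [edge_bar] using this
      subst he
      have h1 := X.bar_ne (X.orient e)
      fin_cases i <;> fin_cases j
      · rfl
      · exact absurd h.symm h1
      · exact absurd h h1
      · rfl
    · intro h
      rcases X.eq_orient_or h with h1 | h1
      · exact ⟨(0, X.edge h), by simpa using h1.symm⟩
      · exact ⟨(1, X.edge h), by simpa using h1.symm⟩)

@[simp] theorem orientEquiv_zero (e : X.Edge) : X.orientEquiv (0, e) = X.orient e := rfl

@[simp] theorem orientEquiv_one (e : X.Edge) : X.orientEquiv (1, e) = X.bar (X.orient e) := rfl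

theorem sum_halfEdge [Fintype H] {M : Type*} [AddCommMonoid M] (φ : H → M) :
    ∑ h, φ h = ∑ e, (φ (X.orient e) + φ (X.bar (X.orient e))) := by
  rw [← Equiv.sum_comp X.orientEquiv, Fintype.sum_prod_type_right]
  simp

@[simp] theorem tgt_bar (h : H) : X.tgt (X.bar h) = X.src h := by rw [tgt, X.bar_bar, src]

@[simp] theorem src_bar (h : H) : X.src (X.bar h) = X.tgt h := rfl

/-- The matrix `c h` at `(h, bar h)`. -/
def barMatrix (c : H → ℂ) : Matrix H H ℂ := Matrix.of fun h k => if k = X.bar h then c h else 0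

theorem det_one_add_barMatrix [Fintype H] (c : H → ℂ) :
    (1 + X.barMatrix c).det = ∏ e, (1 - c (X.orient e) * c (X.bar (X.orient e))) := by
  rw [← Matrix.det_submatrix_equiv_self X.orientEquiv]
  have : (1 + X.barMatrix c).submatrix X.orientEquiv X.orientEquiv = Matrix.blockDiagonal
      fun e => !![1, c (X.orient e); c (X.bar (X.orient e)), 1] := by
    ext ⟨i, e⟩ ⟨j, e'⟩
    rw [Matrix.blockDiagonal_apply, Matrix.submatrix_apply, Matrix.add_apply, Matrix.one_apply,
      X.orientEquiv.injective.eq_iff, barMatrix, Matrix.of_apply]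
    have hbar : (X.orientEquiv (j, e') = X.bar (X.orientEquiv (i, e))) ↔ (j ≠ i ∧ e = e') := by
      have h1 : X.bar (X.orientEquiv (i, e)) = X.orientEquiv (i + 1, e) := by
        fin_cases i
        · simp
        · simp [X.bar_bar]
      rw [h1, X.orientEquiv.injective.eq_iff, Prod.mk.injEq, eq_comm (a := e')]
      refine and_congr_left fun _ => ?_
      fin_cases i <;> fin_cases j <;> simp
    simp only [hbar]
    by_cases he : e = e'
    · subst he
      fin_cases i <;> fin_cases j <;> simp
    · simp [he]
  rw [this, Matrix.det_blockDiagonal]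
  simp [Matrix.det_fin_two]

theorem barMatrix_mul_self [Fintype H] (c : H → ℂ) :
    X.barMatrix c * X.barMatrix c = Matrix.diagonal fun h => c h * c (X.bar h) := by
  ext h k
  rw [Matrix.mul_apply, Matrix.diagonal_apply, Finset.sum_eq_single (X.bar h)]
  · simp [barMatrix, X.bar_bar, eq_comm]
  · intro j _ hj; simp [barMatrix, hj]
  · simp

/-- A three-term determinant formula of Bass type. -/
theorem det_one_sub_edgeMatrix [Fintype V] [Fintype H] (c : H → ℂ)
    (hc : ∀ h, 1 - c h * c (X.bar h) ≠ 0) :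
    (1 - X.edgeMatrix c).det = (∏ e, (1 - c (X.orient e) * c (X.bar (X.orient e)))) *
      (1 + Matrix.of fun v w => ∑ h, if X.src h = v then
        (1 - c h * c (X.bar h))⁻¹ * ((if v = w then c h * c (X.bar h) else 0) -
          if X.tgt h = w then c h else 0) else 0 : Matrix V V ℂ).det := by
  set N := X.barMatrix c with hN
  set T : Matrix H V ℂ := Matrix.of fun h v => if X.tgt h = v then c h else 0 with hT
  set S : Matrix V H ℂ := Matrix.of fun v h => if X.src h = v then 1 else 0 with hS
  set Q : Matrix H H ℂ := Matrix.diagonal fun h => (1 - c h * c (X.bar h))⁻¹ with hQ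
  -- All concatenations factor through the vertices; `N` removes the backtracking ones.
  have hW : X.edgeMatrix c = T * S - N := by
    ext h k
    simp only [edgeMatrix, hT, hS, hN, barMatrix, Matrix.sub_apply, Matrix.mul_apply,
      Matrix.of_apply, Follows]
    have h1 : ∑ x, (if X.tgt h = x then c h else 0) * (if X.src k = x then (1 : ℂ) else 0)
        = if X.tgt h = X.src k then c h else 0 := by
      rw [Finset.sum_eq_single (X.src k)]
      · simp
      · intro v _ hv; simp [hv.symm]
      · simp
    rw [h1]
    by_cases hk : k = X.bar h
    · subst hk
      simp [tgt, src]
    · simp [hk]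
  have hK : (Q * (1 - N)) * (1 + N) = 1 := by
    rw [Matrix.mul_assoc, show (1 - N) * (1 + N) = 1 - N * N by noncomm_ring, hN,
      barMatrix_mul_self, hQ, ← Matrix.diagonal_one, Matrix.diagonal_sub,
      Matrix.diagonal_mul_diagonal]
    congr 1
    ext h
    exact inv_mul_cancel₀ (hc h)
  have hK' : (1 + N) * (Q * (1 - N)) = 1 := mul_eq_one_comm.1 hK
  have h1 : 1 - X.edgeMatrix c = (1 + N) * (1 - (Q * (1 - N) * T) * S) := by
    rw [Matrix.mul_sub, Matrix.mul_one, hW, ← Matrix.mul_assoc, ← Matrix.mul_assoc, hK',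
      Matrix.one_mul]
    abel
  rw [h1, Matrix.det_mul, det_one_add_barMatrix, Matrix.det_one_sub_mul_comm]
  congr 2
  rw [sub_eq_add_neg]
  congr 1
  ext v w
  have hNT : ∀ h, (N * T) h w = if X.src h = w then c h * c (X.bar h) else 0 := by
    intro h
    rw [Matrix.mul_apply, Finset.sum_eq_single (X.bar h)]
    · simp [hN, barMatrix, hT]
    · intro j _ hj; simp [hN, barMatrix, hj]
    · simp
  have hQT : ∀ h, (Q * (1 - N) * T : Matrix H V ℂ) h w = (1 - c h * c (X.bar h))⁻¹ *
      ((if X.tgt h = w then c h else 0) - if X.src h = w then c h * c (X.bar h) else 0) := by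
    intro h
    rw [Matrix.mul_assoc, Matrix.sub_mul, Matrix.one_mul, hQ, Matrix.diagonal_mul,
      Matrix.sub_apply, hNT]
    rfl
  rw [Matrix.neg_apply, Matrix.mul_apply, ← Finset.sum_neg_distrib]
  refine Finset.sum_congr rfl fun h _ => ?_
  rw [hQT, hS, Matrix.of_apply]
  by_cases hv : X.src h = v
  · simp only [hv, if_true]
    ring
  · simp [hv]

/-- The twisted Laplacian with edge weights `y`. -/
def laplacian [Fintype H] (r : H → ℂ) (y : X.Edge → ℂ) : Matrix V V ℂ :=
  Matrix.of fun v w => ∑ h, if X.src h = v then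
    y (X.edge h) * ((if v = w then 1 else 0) - if X.tgt h = w then r h else 0) else 0

/-- Off `s = 1` the determinant is `(s - 1) ^ (genus - 1)` times a function `F` that is
differentiable at 1, so the error is controlled by `F s - F 1 = O(s - 1)`. -/
theorem isBigO_det_one_sub_edgeMatrix [Fintype V] [Fintype H] (r : H → ℂ)
    (hr : ∀ h, r h * r (X.bar h) = 1) (x : X.Edge → ℂ) (hx : ∀ e, x e ≠ 0) :
    (fun s : ℂ => (1 - X.edgeMatrix fun h => r h * s ^ x (X.edge h)).det -
      (-2) ^ (X.genus - 1) * ((∏ e, x e) * (X.laplacian r fun e => (x e)⁻¹).det) *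
        (s - 1) ^ (X.genus - 1)) =O[𝓝[≠] 1] fun s : ℂ => (s - 1) ^ X.genus := by
  -- The quotient of `1 - s ^ (2 x_e)` by `s - 1` with the removable singularity filled in; its
  -- value at 1 is `-2 * x e`.
  set a : X.Edge → ℂ → ℂ := fun e => dslope (fun s : ℂ => 1 - (s ^ x e) ^ 2) 1 with ha
  have hpow : ∀ e, DifferentiableOn ℂ (fun s : ℂ => s ^ x e) Complex.slitPlane := fun e s hs =>
    ((hasDerivAt_id s).cpow_const hs).differentiableAt.differentiableWithinAt
  have h1mem : (1 : ℂ) ∈ Complex.slitPlane := by simp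
  have hnhds : Complex.slitPlane ∈ 𝓝 (1 : ℂ) := Complex.isOpen_slitPlane.mem_nhds h1mem
  have hadiff : ∀ e, DifferentiableAt ℂ (a e) 1 := by
    intro e
    have h1 : DifferentiableOn ℂ (fun s : ℂ => 1 - (s ^ x e) ^ 2) Complex.slitPlane :=
      (differentiableOn_const _).sub ((hpow e).pow 2)
    exact ((Complex.differentiableOn_dslope hnhds).2 h1).differentiableAt hnhds
  have ha1 : ∀ e, a e 1 = -2 * x e := by
    intro e
    rw [ha]
    simp only [dslope_same]
    have h1 : HasDerivAt (fun s : ℂ => 1 - (s ^ x e) ^ 2) _ 1 :=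
      (((hasDerivAt_id (1 : ℂ)).cpow_const (c := x e) h1mem).pow 2).const_sub 1
    rw [h1.deriv]
    simp
  -- This is `s - 1` times the vertex matrix of the Bass-type formula: the pole is cleared and the
  -- identity term vanishes at 1.
  set M : ℂ → Matrix V V ℂ := fun s => Matrix.of fun v w => (if v = w then s - 1 else 0) +
    ∑ h, if X.src h = v then (a (X.edge h) s)⁻¹ *
      ((if v = w then (s ^ x (X.edge h)) ^ 2 else 0) -
        if X.tgt h = w then r h * s ^ x (X.edge h) else 0) else 0 with hM
  set F : ℂ → ℂ := fun s => (∏ e, a e s) * (M s).det with hF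
  have hFdiff : DifferentiableAt ℂ F 1 := by
    have hp : ∀ e, DifferentiableAt ℂ (fun s : ℂ => s ^ x e) 1 := fun e =>
      (hpow e).differentiableAt hnhds
    have hMd : ∀ v w, DifferentiableAt ℂ (fun s => M s v w) 1 := by
      intro v w
      simp only [hM, Matrix.of_apply]
      refine DifferentiableAt.add ?_ (DifferentiableAt.fun_sum fun h _ => ?_)
      · split_ifs
        · exact differentiableAt_id.sub_const 1
        · exact differentiableAt_const _
      · split_ifs
        all_goals
          first
          | exact differentiableAt_const _
          | (refine DifferentiableAt.mul (DifferentiableAt.inv (hadiff _) ?_) ?_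
             · rw [ha1]; exact mul_ne_zero (by norm_num) (hx _)
             · exact DifferentiableAt.sub (by first | exact (hp _).pow 2 | exact differentiableAt_const _)
                (by first | exact (hp _).const_mul _ | exact differentiableAt_const _))
    refine DifferentiableAt.mul (DifferentiableAt.fun_finsetProd fun e _ => hadiff e) ?_
    simp only [Matrix.det_apply]
    refine DifferentiableAt.fun_sum fun σ _ => DifferentiableAt.const_smul ?_ _
    exact DifferentiableAt.fun_finsetProd fun v _ => hMd _ _
  have hn : X.genus - 1 = (Fintype.card X.Edge : ℤ) - Fintype.card V := by
    rw [genus]; ring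
  have hF1 : F 1 = (-2) ^ (X.genus - 1) * ((∏ e, x e) * (X.laplacian r fun e => (x e)⁻¹).det) := by
    have hM1 : M 1 = (-2 : ℂ)⁻¹ • X.laplacian r fun e => (x e)⁻¹ := by
      ext v w
      simp only [hM, laplacian, Matrix.smul_apply, Matrix.of_apply, smul_eq_mul, Finset.mul_sum,
        sub_self, ite_self, zero_add, ha1, Complex.one_cpow, one_pow, mul_one]
      refine Finset.sum_congr rfl fun h _ => ?_
      rw [mul_inv]
      split_ifs <;> ring
    simp only [hF, ha1, hM1, Matrix.det_smul, Finset.prod_mul_distrib, Finset.prod_const,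
      Finset.card_univ]
    rw [hn, zpow_sub₀ (by norm_num), zpow_natCast, zpow_natCast, inv_pow]
    ring
  have hO : (fun s => F s - F 1) =O[𝓝[≠] 1] fun s => s - 1 :=
    hFdiff.isBigO_sub.mono nhdsWithin_le_nhds
  rw [← hF1]
  have hev : (fun s : ℂ => (F s - F 1) * (s - 1) ^ (X.genus - 1)) =ᶠ[𝓝[≠] 1] fun s : ℂ =>
      (1 - X.edgeMatrix fun h => r h * s ^ x (X.edge h)).det - F 1 * (s - 1) ^ (X.genus - 1) := by
    have hne : ∀ᶠ s in 𝓝[≠] (1 : ℂ), ∀ e, a e s ≠ 0 := by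
      rw [eventually_all]
      intro e
      refine nhdsWithin_le_nhds ((hadiff e).continuousAt.eventually_ne ?_)
      rw [ha1]
      exact mul_ne_zero (by norm_num) (hx _)
    filter_upwards [hne, self_mem_nhdsWithin] with s hs hs1
    have ht : s - 1 ≠ 0 := sub_ne_zero.2 hs1
    have hau : ∀ e, 1 - (s ^ x e) ^ 2 = (s - 1) * a e s := by
      intro e
      simp only [ha]
      rw [dslope_of_ne _ hs1, slope_def_field, Complex.one_cpow]
      field_simp
      ring
    have hcc : ∀ h, r h * s ^ x (X.edge h) * (r (X.bar h) * s ^ x (X.edge (X.bar h))) =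
        (s ^ x (X.edge h)) ^ 2 := by
      intro h
      rw [edge_bar]
      linear_combination (s ^ x (X.edge h)) ^ 2 * hr h
    rw [det_one_sub_edgeMatrix]
    swap
    · intro h
      rw [hcc, hau]
      exact mul_ne_zero ht (hs _)
    have hMs : M s = (s - 1) • (1 + Matrix.of fun v w => ∑ h, if X.src h = v then
        (1 - r h * s ^ x (X.edge h) * (r (X.bar h) * s ^ x (X.edge (X.bar h))))⁻¹ *
          ((if v = w then r h * s ^ x (X.edge h) * (r (X.bar h) * s ^ x (X.edge (X.bar h)))
            else 0) - if X.tgt h = w then r h * s ^ x (X.edge h) else 0) else 0 :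
              Matrix V V ℂ) := by
      ext v w
      simp only [hM, hcc, hau, Matrix.smul_apply, Matrix.add_apply, Matrix.of_apply, smul_eq_mul,
        mul_add, Finset.mul_sum, Matrix.one_apply]
      congr 1
      · split_ifs <;> simp
      · refine Finset.sum_congr rfl fun h _ => ?_
        have := hs (X.edge h)
        split_ifs <;> (field_simp; try simp)
    have hdetM := congrArg Matrix.det hMs
    rw [Matrix.det_smul] at hdetM
    simp only [hF, hdetM]
    have hprod : ∏ e, (1 - r (X.orient e) * s ^ x (X.edge (X.orient e)) *
        (r (X.bar (X.orient e)) * s ^ x (X.edge (X.bar (X.orient e))))) =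
        (s - 1) ^ Fintype.card X.Edge * ∏ e, a e s := by
      rw [← Finset.card_univ, ← Finset.prod_const, ← Finset.prod_mul_distrib]
      refine Finset.prod_congr rfl fun e _ => ?_
      rw [hcc, hau, edge_orient]
    rw [hprod, hn, zpow_sub₀ ht, zpow_natCast, zpow_natCast]
    field_simp
  refine (IsBigO.congr' (hO.mul (isBigO_refl (fun s : ℂ => (s - 1) ^ (X.genus - 1)) _)) hev ?_)
  filter_upwards [self_mem_nhdsWithin] with s hs1
  have ht : s - 1 ≠ 0 := sub_ne_zero.2 hs1
  rw [← zpow_one_add₀ ht]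
  congr 1
  ring

end SGraph

/-! ### Determinants along cycles and flows -/

/-- For `n ≥ 2`, expand along the first column: only the first and last rows contribute, with
triangular minors of diagonals `1` and `-c i`. -/
theorem Matrix.det_one_sub_cyclic {R : Type*} [CommRing R] {n : ℕ} (hn : 0 < n) (c : Fin n → R) :
    (Matrix.of fun i j : Fin n => (if i = j then 1 else 0) -
      if (j : ℕ) = (i + 1) % n then c i else 0).det = 1 - ∏ i, c i := by
  obtain ⟨m, rfl⟩ := Nat.exists_eq_succ_of_ne_zero hn.ne'
  cases m with
  | zero => simp
  | succ m =>
    have hmod : ∀ i : ℕ, i < m + 2 → (i + 1) % (m + 2) = if i = m + 1 then 0 else i + 1 := by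
      intro i hi
      split_ifs with h
      · subst h; simp
      · exact Nat.mod_eq_of_lt (by omega)
    set A : Matrix (Fin (m + 2)) (Fin (m + 2)) R := Matrix.of fun i j =>
      (if i = j then 1 else 0) - if (j : ℕ) = (i + 1) % (m + 2) then c i else 0 with hA
    have hA0 : ∀ i j : Fin (m + 2), (i : ℕ) ≠ j →
        (j : ℕ) ≠ (if (i : ℕ) = m + 1 then 0 else (i : ℕ) + 1 : ℕ) → A i j = 0 := by
      intro i j h1 h2
      rw [hA, Matrix.of_apply, hmod i i.2, if_neg (fun h => h1 (congrArg _ h)), if_neg h2, sub_zero]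
    have hA1 : ∀ i j : Fin (m + 2), (i : ℕ) = j →
        (j : ℕ) ≠ (if (i : ℕ) = m + 1 then 0 else (i : ℕ) + 1 : ℕ) → A i j = 1 := by
      intro i j h1 h2
      rw [hA, Matrix.of_apply, hmod i i.2, if_pos (Fin.ext h1), if_neg h2, sub_zero]
    have hA2 : ∀ i j : Fin (m + 2), (i : ℕ) ≠ j →
        (j : ℕ) = (if (i : ℕ) = m + 1 then 0 else (i : ℕ) + 1 : ℕ) → A i j = -c i := by
      intro i j h1 h2
      rw [hA, Matrix.of_apply, hmod i i.2, if_neg (fun h => h1 (congrArg _ h)), if_pos h2, zero_sub]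
    change A.det = _
    rw [det_succ_column_zero, Fin.sum_univ_succ, Fin.sum_univ_castSucc]
    have h0 : (A.submatrix (Fin.succAbove 0) Fin.succ).det = 1 := by
      rw [Fin.succAbove_zero, det_of_isUpperTriangular]
      · refine Finset.prod_eq_one fun i _ => hA1 _ _ rfl ?_
        have := i.2
        rw [Fin.val_succ]
        split_ifs <;> omega
      · intro i j hij
        have hij' : (j : ℕ) < i := hij
        have := i.2
        refine hA0 _ _ ?_ ?_ <;> rw [Fin.val_succ, Fin.val_succ]
        · omega
        · split_ifs <;> omega
    have h1 : (A.submatrix (Fin.succAbove (Fin.last (m + 1))) Fin.succ).det =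
        ∏ i : Fin (m + 1), -c i.castSucc := by
      rw [det_of_isLowerTriangular]
      · refine Finset.prod_congr rfl fun i _ => ?_
        have := i.2
        rw [submatrix_apply, hA2] <;>
          simp only [Fin.succAbove_last, Fin.val_succ, Fin.val_castSucc]
        · omega
        · split_ifs <;> omega
      · intro i j hij
        have hij' : (i : ℕ) < j := hij
        have := i.2
        refine hA0 _ _ ?_ ?_ <;> simp only [Fin.succAbove_last, Fin.val_succ, Fin.val_castSucc]
        · omega
        · split_ifs <;> omega
    have hmid : ∀ i : Fin m, A i.castSucc.succ 0 = 0 := by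
      intro i
      have := i.2
      refine hA0 _ _ ?_ ?_ <;> simp only [Fin.val_succ, Fin.val_castSucc, Fin.val_zero]
      · omega
      · split_ifs <;> omega
    have h00 : A 0 0 = 1 := hA1 _ _ rfl (by simp)
    have hl0 : A (Fin.last m).succ 0 = -c (Fin.last (m + 1)) := hA2 _ _ (by simp) (by simp)
    have hsucc : (Fin.last m).succ = Fin.last (m + 1) := rfl
    simp only [hmid, h00, hl0, h0, mul_zero, zero_mul, Finset.sum_const_zero, zero_add]
    rw [hsucc, h1, Finset.prod_neg, Fin.prod_univ_castSucc (n := m + 1) (f := c)]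
    simp only [Fin.val_zero, pow_zero, Fin.val_last, Finset.card_univ, Fintype.card_fin]
    have : ((-1 : R) ^ (m + 1)) * (-1) ^ (m + 1) = 1 := by
      rw [← mul_pow]; simp
    linear_combination (-(c (Fin.last (m + 1))) * ∏ i : Fin (m + 1), c i.castSucc) * this

namespace SGraph

variable {V H : Type*} (X : SGraph V H)

variable {X} in
theorem IsClosedReduced.follows {P : List H} (hP : X.IsClosedReduced P) {i : ℕ}
    (hi : i < P.length) :
    X.Follows P[i] (P[(i + 1) % P.length]'(Nat.mod_lt _ (by omega))) := by
  obtain ⟨hne, hch⟩ := hP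
  cases P with
  | nil => exact absurd rfl hne
  | cons a l =>
    rw [Cycle.chain_coe_cons, List.isChain_iff_getElem] at hch
    have := hch i (by simpa using hi)
    simp only [List.length_cons] at hi
    have hget : ∀ (j : ℕ) (hj : j < l.length + 1),
        (a :: (l ++ [a]))[j]'(by simp; omega) = (a :: l)[j] := fun j hj =>
      List.getElem_append_left (as := a :: l) (bs := [a]) hj
    have hlast : (a :: (l ++ [a]))[l.length + 1]'(by simp) = a := by simp
    rcases Nat.lt_or_ge (i + 1) (l.length + 1) with h | h
    · simp only [List.length_cons, Nat.mod_eq_of_lt h]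
      rwa [hget i hi, hget (i + 1) h] at this
    · obtain rfl : i = l.length := by omega
      simp only [List.length_cons, Nat.mod_self]
      rwa [hget _ hi, hlast] at this

theorem delete_adj_iff (F : Set X.Edge) {u v : V} :
    (X.delete F).Adj u v ↔ u ≠ v ∧ ∃ h, X.edge h ∉ F ∧ X.src h = u ∧ X.tgt h = v := by
  rw [delete, SimpleGraph.fromRel_adj]
  refine and_congr_right fun _ => ⟨?_, Or.inl⟩
  rintro (h | ⟨h, h1, h2, h3⟩)
  · exact h
  · exact ⟨X.bar h, by rwa [edge_bar], by rwa [src_bar], by rwa [tgt_bar]⟩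

theorem connectedComponentMk_src {F : Set X.Edge} {h : H} (hh : X.edge h ∉ F) :
    (X.delete F).connectedComponentMk (X.src h) = (X.delete F).connectedComponentMk (X.tgt h) := by
  by_cases he : X.src h = X.tgt h
  · rw [he]
  · exact SimpleGraph.ConnectedComponent.sound
      ((X.delete_adj_iff F).2 ⟨he, h, hh, rfl, rfl⟩).reachable

/-- Given one cycle in every component, orient the graph towards the cycles: there is a choice of an
outgoing half-edge at every vertex that follows the cycles and otherwise decreases a height function
which vanishes exactly on the cycles. -/
theorem exists_flow (F : Set X.Edge) (P : (X.delete F).ConnectedComponent → List H)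
    (hP : ∀ C, X.IsCycleOf F C (P C)) :
    ∃ (k : V → H) (d : V → ℕ), (∀ v, X.src (k v) = v) ∧ (∀ v, X.edge (k v) ∉ F) ∧
      (∀ v, d v = 0 → k v ∈ P ((X.delete F).connectedComponentMk v)) ∧
      (∀ C, ∀ h ∈ P C, d (X.src h) = 0 ∧ k (X.src h) = h) ∧
      (∀ v, d v ≠ 0 → d (X.tgt (k v)) < d v) := by
  -- `Z` is the set of vertices on the chosen cycles, and `d` below is the distance to `Z` in `X \
  -- F`; off `Z`, `k` is the first step of a shortest walk.
  set Z : Set V := {v | ∃ h ∈ P ((X.delete F).connectedComponentMk v), X.src h = v} with hZ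
  set S : V → Set ℕ := fun v => {n | ∃ z ∈ Z, ∃ p : (X.delete F).Walk v z, p.length = n} with hS
  have hSne : ∀ v, (S v).Nonempty := by
    intro v
    obtain ⟨⟨hne, -⟩, -, hmem⟩ := hP ((X.delete F).connectedComponentMk v)
    obtain ⟨h, hh⟩ := List.exists_mem_of_ne_nil _ hne
    have hc := (hmem h hh).2
    rw [SimpleGraph.ConnectedComponent.mem_supp_iff] at hc
    obtain ⟨p⟩ := (SimpleGraph.ConnectedComponent.exact hc).symm
    exact ⟨p.length, X.src h, ⟨h, by rwa [hc], rfl⟩, p, rfl⟩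
  set d : V → ℕ := fun v => sInf (S v) with hd
  have hd0 : ∀ v, d v = 0 → v ∈ Z := by
    intro v hv
    have := Nat.sInf_mem (hSne v)
    change d v ∈ S v at this
    rw [hv] at this
    obtain ⟨z, hz, p, hp⟩ := this
    rwa [SimpleGraph.Walk.eq_of_length_eq_zero hp]
  have hd0' : ∀ v ∈ Z, d v = 0 := fun v hv =>
    Nat.sInf_eq_zero.2 (Or.inl ⟨v, hv, SimpleGraph.Walk.nil, rfl⟩)
  have hk : ∀ v, ∃ h, X.src h = v ∧ X.edge h ∉ F ∧
      (d v = 0 → h ∈ P ((X.delete F).connectedComponentMk v)) ∧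
      (d v ≠ 0 → d (X.tgt h) < d v) := by
    intro v
    by_cases hv : d v = 0
    · obtain ⟨h, hh, rfl⟩ := hd0 v hv
      exact ⟨h, rfl, ((hP _).2.2 h hh).1, fun _ => hh, fun h0 => absurd hv h0⟩
    · have := Nat.sInf_mem (hSne v)
      obtain ⟨z, hz, p, hp⟩ := this
      cases p with
      | nil => exact absurd (hd0' _ hz) hv
      | cons hadj q =>
        obtain ⟨-, h, hF, rfl, rfl⟩ := (X.delete_adj_iff F).1 hadj
        refine ⟨h, rfl, hF, fun h0 => absurd h0 hv, fun _ => ?_⟩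
        have h1 : d (X.tgt h) ≤ q.length := Nat.sInf_le ⟨z, hz, q, rfl⟩
        have h2 : q.length + 1 = d (X.src h) := hp
        omega
  choose k hk1 hk2 hk3 hk4 using hk
  refine ⟨k, d, hk1, hk2, hk3, ?_, hk4⟩
  intro C h hh
  have hc : (X.delete F).connectedComponentMk (X.src h) = C := ((hP C).2.2 h hh).2
  have h0 : d (X.src h) = 0 := hd0' _ ⟨h, by rwa [hc], rfl⟩
  refine ⟨h0, ?_⟩
  have h1 := hk3 _ h0
  rw [hc] at h1
  exact List.inj_on_of_nodup_map (hP C).2.1 h1 hh (hk1 _)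

variable {X} in
-- If the reverse of `h` were also on the cycle, it would start where `h` ends, hence be the
-- successor of `h`, which reducedness forbids.
theorem IsCycleOf.injOn_edge {F : Set X.Edge} {C : (X.delete F).ConnectedComponent} {P : List H}
    (hP : X.IsCycleOf F C P) {h k : H} (hh : h ∈ P) (hk : k ∈ P) (he : X.edge h = X.edge k) :
    h = k := by
  rcases X.edge_eq_edge_iff.1 he with h1 | h1
  · exact h1.symm
  · exfalso
    obtain ⟨i, hi, rfl⟩ := List.getElem_of_mem hh
    have hf := hP.1.follows hi
    refine hf.2 ?_
    rw [← h1]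
    refine List.inj_on_of_nodup_map hP.2.1 (List.getElem_mem _) hk ?_
    rw [← hf.1, h1, src_bar]

/-- Two distinct vertices sharing an edge would be each other's successors. Heights cannot decrease
both ways, and height zero stays zero, so both lie on one cycle, where edges do not repeat. -/
theorem edge_flow_injective {F : Set X.Edge} {P : (X.delete F).ConnectedComponent → List H}
    (hP : ∀ C, X.IsCycleOf F C (P C)) {k : V → H} {d : V → ℕ} (hk1 : ∀ v, X.src (k v) = v)
    (hk2 : ∀ v, X.edge (k v) ∉ F)
    (hk3 : ∀ v, d v = 0 → k v ∈ P ((X.delete F).connectedComponentMk v))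
    (hk4 : ∀ C, ∀ h ∈ P C, d (X.src h) = 0 ∧ k (X.src h) = h)
    (hk5 : ∀ v, d v ≠ 0 → d (X.tgt (k v)) < d v) :
    Function.Injective fun v => X.edge (k v) := by
  intro v w he
  have he' : X.edge (k v) = X.edge (k w) := he
  rcases X.edge_eq_edge_iff.1 he' with h1 | h1
  · rw [← hk1 v, ← hk1 w, h1]
  · have hvw : X.tgt (k v) = w := by rw [← src_bar, ← h1, hk1]
    have hwv : X.tgt (k w) = v := by rw [h1, tgt_bar, hk1]
    have hc := X.connectedComponentMk_src (hk2 v)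
    rw [hk1, hvw] at hc
    have hnext : ∀ u, d u = 0 → d (X.tgt (k u)) = 0 := by
      intro u hu
      obtain ⟨i, hi, hi'⟩ := List.getElem_of_mem (hk3 u hu)
      have hf := (hP _).1.follows hi
      rw [hi'] at hf
      rw [hf.1]
      exact (hk4 _ _ (List.getElem_mem _)).1
    by_cases hv : d v = 0
    · have hw : d w = 0 := by rw [← hvw]; exact hnext v hv
      have h2 := hk3 w hw
      rw [← hc] at h2
      have := (hP _).injOn_edge (hk3 v hv) h2 he'
      rw [← hk1 v, ← hk1 w, this]
    · have h2 := hk5 v hv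
      rw [hvw] at h2
      by_cases hw : d w = 0
      · have := hnext w hw
        rw [hwv] at this
        exact absurd this hv
      · have h3 := hk5 w hw
        rw [hwv] at h3
        omega

/-- Group the vertices by height, then by component. Arrows never raise the height and stay in their
component, so the matrix is block triangular; height-zero blocks are cyclic matrices, and the other
blocks are identities. -/
theorem det_flow [Fintype V] {F : Set X.Edge} {P : (X.delete F).ConnectedComponent → List H}
    (hP : ∀ C, X.IsCycleOf F C (P C)) {k : V → H} {d : V → ℕ} (hk1 : ∀ v, X.src (k v) = v)
    (hk2 : ∀ v, X.edge (k v) ∉ F)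
    (hk3 : ∀ v, d v = 0 → k v ∈ P ((X.delete F).connectedComponentMk v))
    (hk4 : ∀ C, ∀ h ∈ P C, d (X.src h) = 0 ∧ k (X.src h) = h)
    (hk5 : ∀ v, d v ≠ 0 → d (X.tgt (k v)) < d v) (r : H → ℂ) :
    (Matrix.of fun v w => (if v = w then 1 else 0) - if X.tgt (k v) = w then r (k v) else 0 :
      Matrix V V ℂ).det = ∏ C, (1 - ((P C).map r).prod) := by
  set N : Matrix V V ℂ := Matrix.of fun v w =>
    (if v = w then 1 else 0) - if X.tgt (k v) = w then r (k v) else 0 with hN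
  set cc := (X.delete F).connectedComponentMk with hcc
  set idx := Fintype.equivFin (X.delete F).ConnectedComponent with hidx
  set b : V → Lex (ℕ × Fin (Fintype.card (X.delete F).ConnectedComponent)) := fun v =>
    toLex (d v, idx (cc v)) with hb
  have hbtri : N.transpose.BlockTriangular b := by
    intro i j hij
    rw [Matrix.transpose_apply, hN, Matrix.of_apply]
    have hne : j ≠ i := by rintro rfl; exact lt_irrefl _ hij
    rw [if_neg hne, zero_sub, neg_eq_zero]
    refine if_neg ?_
    rintro rfl
    refine absurd hij (not_lt.2 ?_)
    have hc : cc (X.tgt (k j)) = cc j := by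
      have := X.connectedComponentMk_src (hk2 j)
      rw [hk1] at this
      exact this.symm
    rw [Prod.Lex.le_iff]
    simp only [hb, ofLex_toLex, hc, le_refl, and_true]
    by_cases hj : d j = 0
    · right
      obtain ⟨i, hi, hi'⟩ := List.getElem_of_mem (hk3 j hj)
      have hf := (hP _).1.follows hi
      rw [hi'] at hf
      rw [hf.1, hj]
      exact (hk4 _ _ (List.getElem_mem _)).1
    · exact Or.inl (hk5 j hj)
  have hPne : ∀ C, P C ≠ [] := fun C => (hP C).1.1
  have hccP : ∀ C, ∀ h ∈ P C, cc (X.src h) = C := fun C h hh => ((hP C).2.2 h hh).2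
  rw [← Matrix.det_transpose, hbtri.det]
  set s : Finset (Lex (ℕ × Fin (Fintype.card (X.delete F).ConnectedComponent))) :=
    Finset.univ.image fun C => toLex (0, idx C) with hs
  have hsub : s ⊆ Finset.univ.image b := by
    intro a ha
    obtain ⟨C, -, rfl⟩ := Finset.mem_image.1 ha
    obtain ⟨h, hh⟩ := List.exists_mem_of_ne_nil _ (hPne C)
    refine Finset.mem_image.2 ⟨X.src h, Finset.mem_univ _, ?_⟩
    simp only [hb, (hk4 C h hh).1, hccP C h hh]
  rw [← Finset.prod_subset hsub, hs, Finset.prod_image]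
  · refine Finset.prod_congr rfl fun C _ => ?_
    set n := (P C).length with hn
    have hn0 : 0 < n := List.length_pos_iff.2 (hPne C)
    have hsrc : ∀ {i j : ℕ} (hi : i < n) (hj : j < n),
        X.src (P C)[i] = X.src (P C)[j] ↔ i = j := by
      intro i j hi hj
      have := (hP C).2.1.getElem_inj_iff (i := i) (j := j) (hi := by simpa using hi)
        (hj := by simpa using hj)
      rw [← this]
      simp
    let e : Fin n ≃ {v // b v = toLex (0, idx C)} := Equiv.ofBijective
      (fun i => ⟨X.src (P C)[(i : ℕ)], by
        simp only [hb]
        rw [(hk4 C _ (List.getElem_mem _)).1, hccP C _ (List.getElem_mem _)]⟩) (by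
      constructor
      · intro i j hij
        exact Fin.ext ((hsrc i.2 j.2).1 (congrArg Subtype.val hij))
      · rintro ⟨v, hv⟩
        simp only [hb, EmbeddingLike.apply_eq_iff_eq, Prod.mk.injEq] at hv
        have h1 := hk3 v hv.1
        change k v ∈ P (cc v) at h1
        rw [hv.2] at h1
        obtain ⟨i, hi, hi'⟩ := List.getElem_of_mem h1
        refine ⟨⟨i, hi⟩, Subtype.ext ?_⟩
        change X.src (P C)[i] = v
        rw [hi', hk1])
    have he : ∀ i, (e i : V) = X.src (P C)[i] := fun i => rfl
    rw [← Matrix.det_submatrix_equiv_self e, ← Matrix.det_transpose]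
    have := Matrix.det_one_sub_cyclic hn0 fun i : Fin n => r (P C)[i]
    have hprod : ∏ i : Fin n, r (P C)[i] = ((P C).map r).prod := by
      rw [← List.prod_ofFn]
      congr 1
      exact List.ofFn_getElem_eq_map (P C) r
    rw [← hprod, ← this]
    congr 1
    ext i j
    rw [Matrix.transpose_apply, Matrix.submatrix_apply, Matrix.toSquareBlock_def, Matrix.of_apply,
      Matrix.transpose_apply, hN, Matrix.of_apply, Matrix.of_apply]
    have hf := (hP C).1.follows i.2
    have h1 : ((e i : V) = e j) ↔ i = j := by
      rw [he, he, Fin.ext_iff]; exact hsrc i.2 j.2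
    have h2 : k (e i) = (P C)[i] := (hk4 C _ (List.getElem_mem _)).2
    have h3 : (X.tgt (k (e i)) = e j) ↔ (j : ℕ) = (i + 1) % n := by
      rw [h2, he, eq_comm (a := (j : ℕ))]
      have := hf.1
      change X.tgt (P C)[(i : ℕ)] = X.src (P C)[(j : ℕ)] ↔ _
      rw [this]
      exact hsrc (Nat.mod_lt _ hn0) j.2
    simp only [h1, h2 ▸ h3, h2]
  · intro C _ C' _ h
    simpa using h
  · intro a ha has
    obtain ⟨v, -, rfl⟩ := Finset.mem_image.1 ha
    have hv : d v ≠ 0 := by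
      intro h0
      refine has (Finset.mem_image.2 ⟨cc v, Finset.mem_univ _, ?_⟩)
      simp only [hb, h0]
    have : N.transpose.toSquareBlock b (b v) = 1 := by
      ext ⟨i, hi⟩ ⟨j, hj⟩
      rw [Matrix.toSquareBlock_def, Matrix.of_apply, Matrix.transpose_apply, hN, Matrix.of_apply,
        Matrix.one_apply]
      simp only [hb, EmbeddingLike.apply_eq_iff_eq, Prod.mk.injEq] at hi hj
      have hne : X.tgt (k j) ≠ i := by
        intro h
        have := hk5 j (by rw [hj.1]; exact hv)
        rw [h, hi.1, hj.1] at this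
        exact lt_irrefl _ this
      rw [if_neg hne, sub_zero]
      simp [eq_comm]
    rw [this, Matrix.det_one]

end SGraph

/-! ### Twisted incidence matrix, bases and the matrix-tree theorem -/

namespace SGraph

variable {V H : Type*} (X : SGraph V H)

/-- The twisted incidence matrix. -/
def incidence (r : H → ℂ) : Matrix X.Edge V ℂ := Matrix.of fun e v =>
  (if X.src (X.orient e) = v then 1 else 0) - if X.tgt (X.orient e) = v then r (X.orient e) else 0

/-- Reversing an edge multiplies its row by a number of modulus one, so the modulus of a minor does
not see the chosen orientations. -/
theorem exists_incidence_edge {r : H → ℂ} (hr : ∀ h, r h * r (X.bar h) = 1)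
    (hn : ∀ h, ‖r h‖ = 1) (h : H) : ∃ u : ℂ, ‖u‖ = 1 ∧ ∀ w, X.incidence r (X.edge h) w =
      u * ((if X.src h = w then 1 else 0) - if X.tgt h = w then r h else 0) := by
  set o := X.orient (X.edge h) with ho
  rcases X.eq_orient_or h with h1 | h1
  · refine ⟨1, by simp, fun w => ?_⟩
    rw [incidence, Matrix.of_apply, ← h1, one_mul]
  · refine ⟨-r o, by rw [norm_neg, hn], fun w => ?_⟩
    rw [incidence, Matrix.of_apply, ← ho]
    rw [← ho] at h1
    have := hr o
    rw [h1, src_bar, tgt_bar]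
    split_ifs
    · linear_combination -this
    · linear_combination -this
    · ring
    · ring

theorem incidence_mulVec [Fintype V] (r : H → ℂ) (φ : V → ℂ) (e : X.Edge) :
    (X.incidence r).mulVec φ e =
      φ (X.src (X.orient e)) - r (X.orient e) * φ (X.tgt (X.orient e)) := by
  simp [Matrix.mulVec, dotProduct, incidence, sub_mul, Finset.sum_sub_distrib]

theorem laplacian_eq [Fintype V] [Fintype H] {r : H → ℂ}
    (hstar : ∀ h, star (r h) = r (X.bar h)) (hr : ∀ h, r h * r (X.bar h) = 1) (y : X.Edge → ℂ) :
    X.laplacian r y = ((X.incidence r).conjTranspose * Matrix.diagonal y) * X.incidence r := by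
  ext v w
  rw [Matrix.mul_apply, laplacian, Matrix.of_apply, sum_halfEdge]
  refine Finset.sum_congr rfl fun e _ => ?_
  rw [Matrix.mul_diagonal, Matrix.conjTranspose_apply, incidence, Matrix.of_apply, Matrix.of_apply]
  simp only [edge_bar, edge_orient, src_bar, tgt_bar, star_sub, apply_ite star, star_one, star_zero,
    hstar]
  have := hr (X.orient e)
  revert this
  generalize X.src (X.orient e) = s, X.tgt (X.orient e) = t, r (X.orient e) = a,
    r (X.bar (X.orient e)) = b, y e = c
  intro this
  by_cases hvw : v = w
  · subst hvw
    split_ifs <;> first | ring1 | linear_combination -c * this | contradiction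
  · split_ifs <;> first | ring1 | (exfalso; grind)

/-- Follow `k` from vertex to vertex until the orbit is periodic. Edges assigned to distinct
vertices differ, which excludes backtracking; the minimal period makes the vertices distinct. -/
theorem exists_isCycleOf [Finite V] {F : Set X.Edge} {k : V → H} (hk : ∀ v, X.src (k v) = v)
    (hkF : ∀ v, X.edge (k v) ∉ F) (hinj : Function.Injective fun v => X.edge (k v))
    (C : (X.delete F).ConnectedComponent) : ∃ P, X.IsCycleOf F C P := by
  set T : V → V := fun v => X.tgt (k v) with hT
  have hfol : ∀ v, X.Follows (k v) (k (T v)) := by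
    refine fun v => ⟨(hk _).symm, fun h => ?_⟩
    have h1 : X.edge (k (T v)) = X.edge (k v) := by rw [h, edge_bar]
    have h2 : T v = v := hinj h1
    rw [h2] at h
    exact X.bar_ne _ h.symm
  have hC : ∀ v, v ∈ C.supp → ∀ i, T^[i] v ∈ C.supp := by
    intro v hv i
    induction i with
    | zero => exact hv
    | succ i ih =>
      rw [Function.iterate_succ_apply', SimpleGraph.ConnectedComponent.mem_supp_iff]
      have := X.connectedComponentMk_src (hkF (T^[i] v))
      rw [hk] at this
      rw [SimpleGraph.ConnectedComponent.mem_supp_iff] at ih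
      rw [← ih, this]
  obtain ⟨v, hv⟩ := C.nonempty_supp
  obtain ⟨p, hpC, hp⟩ : ∃ p ∈ C.supp, p ∈ Function.periodicPts T := by
    obtain ⟨m, n, hmn, he⟩ := Finite.exists_ne_map_eq_of_infinite fun n : ℕ => T^[n] v
    have aux : ∀ m n : ℕ, m < n → T^[m] v = T^[n] v →
        ∃ p ∈ C.supp, p ∈ Function.periodicPts T := by
      intro m n hlt he
      refine ⟨T^[m] v, hC v hv m, n - m, by omega, ?_⟩
      rw [Function.IsPeriodicPt, Function.IsFixedPt, ← Function.iterate_add_apply,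
        Nat.sub_add_cancel hlt.le, he]
    rcases lt_or_gt_of_ne hmn with h | h
    · exact aux m n h he
    · exact aux n m h he.symm
  obtain ⟨m, hm⟩ := Nat.exists_eq_succ_of_ne_zero
    (Function.minimalPeriod_pos_of_mem_periodicPts hp).ne'
  refine ⟨(List.range (m + 1)).map fun i => k (T^[i] p), ⟨by simp, ?_⟩, ?_, ?_⟩
  · rw [← Cycle.map_coe, Cycle.chain_map, Cycle.chain_range_succ]
    constructor
    · have := hfol (T^[m] p)
      rw [← Function.iterate_succ_apply' T m p] at this
      have hper : T^[m.succ] p = p := by rw [← hm]; exact Function.iterate_minimalPeriod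
      rw [hper] at this
      exact this
    · intro i _
      rw [Function.iterate_succ_apply']
      exact hfol _
  · rw [List.map_map]
    refine List.Nodup.map_on ?_ List.nodup_range
    intro i hi j hj hij
    simp only [Function.comp_apply, hk] at hij
    refine Function.iterate_injOn_Iio_minimalPeriod (f := T) (x := p) ?_ ?_ hij
    · rw [hm]; exact List.mem_range.1 hi
    · rw [hm]; exact List.mem_range.1 hj
  · intro h hh
    obtain ⟨i, -, rfl⟩ := List.mem_map.1 hh
    exact ⟨hkF _, by rw [hk]; exact hC p hpC i⟩

variable {G : Type*} [AddCommGroup G]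

section Independence

variable [Fintype V] {η : H → G} {ρ : AddChar G ℂ}

/-- Independence means that the incidence rows outside `F` have trivial kernel: a nonzero kernel
vector, scaled at one vertex of its support, is a `ρ(G)`-valued trivialization on that component,
and conversely. -/
theorem isIndep_iff (hη : ∀ h, η (X.bar h) = -η h) (F : Finset X.Edge) :
    X.IsIndep η ρ F ↔
      ∀ φ : V → ℂ, (∀ e ∉ F, (X.incidence (fun h => ρ (η h))).mulVec φ e = 0) → φ = 0 := by
  constructor
  · intro hF φ hφ
    have hφ' : ∀ h, X.edge h ∉ F → φ (X.src h) = ρ (η h) * φ (X.tgt h) := by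
      intro h hh
      have h1 := hφ _ hh
      rw [incidence_mulVec, sub_eq_zero] at h1
      rcases X.eq_orient_or h with h2 | h2
      · rw [← h2] at h1; exact h1
      · rw [h2, src_bar, tgt_bar, h1, hη, ← mul_assoc, ← AddChar.map_add_eq_mul]
        simp
    by_contra hne
    obtain ⟨v0, hv0⟩ := Function.ne_iff.1 hne
    have hv0' : φ v0 ≠ 0 := hv0
    set C := (X.delete (F : Set X.Edge)).connectedComponentMk v0 with hC
    have key : ∀ v, (X.delete (F : Set X.Edge)).Reachable v v0 → ∃ g, φ v = ρ g * φ v0 := by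
      rintro v ⟨p⟩
      induction p with
      | nil => exact ⟨0, by simp⟩
      | cons hadj p ih =>
        obtain ⟨g, hg⟩ := ih hv0 hv0' rfl
        obtain ⟨-, h, hF', rfl, rfl⟩ := (X.delete_adj_iff _).1 hadj
        refine ⟨η h + g, ?_⟩
        rw [hφ' h (by simpa using hF'), hg, AddChar.map_add_eq_mul, mul_assoc]
    have key' : ∀ v, ∃ g, v ∈ C.supp → φ v = ρ g * φ v0 := by
      intro v
      by_cases hv : v ∈ C.supp
      · obtain ⟨g, hg⟩ := key v (SimpleGraph.ConnectedComponent.exact hv)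
        exact ⟨g, fun _ => hg⟩
      · exact ⟨0, fun h => absurd h hv⟩
    choose g hg using key'
    -- The sign arises because the kernel condition multiplies by `ρ (η h)` from target to source,
    -- while a coboundary goes from source to target.
    refine hF C ⟨fun v => -g v, fun h hh hs => ?_⟩
    have ht : X.tgt h ∈ C.supp := by
      rw [SimpleGraph.ConnectedComponent.mem_supp_iff] at hs ⊢
      rw [← X.connectedComponentMk_src hh, hs]
    have h1 := hφ' h (by simpa using hh)
    rw [hg _ hs, hg _ ht, ← mul_assoc] at h1
    have h2 := mul_right_cancel₀ hv0' h1
    rw [neg_sub_neg, sub_eq_add_neg, AddChar.map_add_eq_mul, h2, mul_assoc,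
      ← AddChar.map_add_eq_mul]
    simp
  · rintro hF C ⟨ξ, hξ⟩
    set φ : V → ℂ := fun v => if v ∈ C.supp then ρ (-ξ v) else 0 with hφ
    have h0 := hF φ (by
      intro e he
      rw [incidence_mulVec, sub_eq_zero]
      have heF : X.edge (X.orient e) ∉ (F : Set X.Edge) := by simpa using he
      have hc := X.connectedComponentMk_src heF
      by_cases hs : X.src (X.orient e) ∈ C.supp
      · have ht : X.tgt (X.orient e) ∈ C.supp := by
          rw [SimpleGraph.ConnectedComponent.mem_supp_iff] at hs ⊢
          rw [← hc, hs]
        simp only [hφ, hs, ht, if_true]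
        rw [hξ _ heF hs, ← AddChar.map_add_eq_mul]
        congr 1
        abel
      · have ht : X.tgt (X.orient e) ∉ C.supp := by
          rw [SimpleGraph.ConnectedComponent.mem_supp_iff] at hs ⊢
          rwa [← hc]
        simp only [hφ, if_neg hs, if_neg ht, mul_zero])
    obtain ⟨v, hv⟩ := C.nonempty_supp
    have h1 := congrFun h0 v
    simp only [hφ, hv, if_true, Pi.zero_apply] at h1
    have h2 : ρ (ξ v) * ρ (-ξ v) = 1 := by rw [← AddChar.map_add_eq_mul]; simp
    rw [h1, mul_zero] at h2
    exact zero_ne_one h2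

variable [Fintype H]

theorem IsIndep.card_le (hη : ∀ h, η (X.bar h) = -η h) {F : Finset X.Edge}
    (hF : X.IsIndep η ρ F) : Fintype.card V ≤ Fᶜ.card := by
  rw [isIndep_iff X hη] at hF
  let L : (V → ℂ) →ₗ[ℂ] ((Fᶜ : Finset X.Edge) → ℂ) :=
    LinearMap.funLeft ℂ ℂ Subtype.val ∘ₗ (X.incidence (fun h => ρ (η h))).mulVecLin
  have hL : Function.Injective L := by
    rw [injective_iff_map_eq_zero]
    intro φ hφ
    refine hF φ fun e he => ?_
    exact congrFun hφ ⟨e, Finset.mem_compl.2 he⟩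
  have := LinearMap.finrank_le_finrank_of_injective hL
  rwa [Module.finrank_fintype_fun_eq_card, Module.finrank_fintype_fun_eq_card,
    Fintype.card_coe] at this

/-- Rows outside `F` that are linearly independent with the same span number at most `|V|`. Their
complement is still independent in the matroid and contains `F`, so it equals `F` by maximality. -/
theorem IsBasis.card_compl (hη : ∀ h, η (X.bar h) = -η h) {F : Finset X.Edge}
    (hF : X.IsBasis η ρ F) : Fᶜ.card = Fintype.card V := by
  refine le_antisymm ?_ (IsIndep.card_le X hη hF.1)
  set B := X.incidence fun h => ρ (η h) with hB
  obtain ⟨κ, a, ha, hspan, hli⟩ := exists_linearIndependent' ℂ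
    fun e : (Fᶜ : Finset X.Edge) => B e.1
  have : Finite κ := Finite.of_injective a ha
  have : Fintype κ := Fintype.ofFinite κ
  set A' : Finset X.Edge := Finset.univ.image fun i => (a i : X.Edge) with hA'
  have hinj : Function.Injective fun i => (a i : X.Edge) := Subtype.val_injective.comp ha
  have hcard : A'.card ≤ Fintype.card V := by
    rw [hA', Finset.card_image_of_injective _ hinj, Finset.card_univ]
    simpa using hli.fintype_card_le_finrank
  have hsub : A' ⊆ Fᶜ := by
    intro e he
    obtain ⟨i, -, rfl⟩ := Finset.mem_image.1 he
    exact (a i).2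
  have hind : X.IsIndep η ρ A'ᶜ := by
    rw [isIndep_iff X hη]
    intro φ hφ
    refine (isIndep_iff X hη F).1 hF.1 φ fun e he => ?_
    have hle : Submodule.span ℂ (Set.range ((fun e : (Fᶜ : Finset X.Edge) => B e.1) ∘ a)) ≤
        LinearMap.ker (LinearMap.flip (dotProductBilin ℂ ℂ) φ) := by
      rw [Submodule.span_le]
      rintro _ ⟨i, rfl⟩
      have h1 := hφ (a i) (by
        rw [Finset.mem_compl, not_not]
        exact Finset.mem_image_of_mem _ (Finset.mem_univ i))
      exact h1
    rw [hspan] at hle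
    exact hle (Submodule.subset_span ⟨⟨e, Finset.mem_compl.2 he⟩, rfl⟩)
  have hFA : F ⊆ A'ᶜ := by
    rw [Finset.subset_compl_comm]; exact hsub
  have := hF.2 hind hFA
  have h2 : F = A'ᶜ := Finset.Subset.antisymm hFA this
  rw [h2, compl_compl]
  exact hcard

/-- With exactly `|V|` edges left, no larger set can be independent, and independence is injectivity
of a square matrix. -/
theorem isBasis_iff_det_ne_zero (hη : ∀ h, η (X.bar h) = -η h) {f : V → X.Edge}
    (hf : Function.Injective f) : X.IsBasis η ρ (Finset.univ.image f)ᶜ ↔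
      ((X.incidence fun h => ρ (η h)).submatrix f id).det ≠ 0 := by
  set F := (Finset.univ.image f)ᶜ with hF
  have hcard : Fᶜ.card = Fintype.card V := by
    rw [hF, compl_compl, Finset.card_image_of_injective _ hf, Finset.card_univ]
  have h1 : X.IsBasis η ρ F ↔ X.IsIndep η ρ F := by
    refine ⟨fun h => h.1, fun h => ⟨h, fun F' hF' hle => ?_⟩⟩
    have h2 := IsIndep.card_le X hη hF'
    have h3 := Finset.card_add_card_compl F
    have h4 := Finset.card_add_card_compl F'
    exact (Finset.eq_of_subset_of_card_le hle (by omega)).symm.subset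
  rw [h1, isIndep_iff X hη, ne_eq, ← Matrix.exists_mulVec_eq_zero_iff]
  push Not
  refine forall_congr' fun φ => ?_
  have h2 : (∀ e ∉ F, (X.incidence fun h => ρ (η h)).mulVec φ e = 0) ↔
      ((X.incidence fun h => ρ (η h)).submatrix f id).mulVec φ = 0 := by
    rw [funext_iff]
    constructor
    · intro h v
      exact h (f v) (by simp [hF])
    · intro h e he
      simp only [hF, Finset.mem_compl, not_not, Finset.mem_image, Finset.mem_univ, true_and] at he
      obtain ⟨v, rfl⟩ := he
      exact h v
  rw [h2]
  tauto

theorem norm_det_incidence_sq [Finite G] (hη : ∀ h, η (X.bar h) = -η h) {f : V → X.Edge}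
    (hf : Function.Injective f) (hb : X.IsBasis η ρ (Finset.univ.image f)ᶜ) :
    ‖((X.incidence fun h => ρ (η h)).submatrix f id).det‖ ^ 2 =
      X.weight η ρ (Finset.univ.image f)ᶜ := by
  set F := (Finset.univ.image f)ᶜ with hF
  set B := X.incidence fun h => ρ (η h) with hB
  have hdet := (isBasis_iff_det_ne_zero X hη hf).1 hb
  have hcyc : ∀ C, X.IsCycleOf (F : Set X.Edge) C (X.cycleOf (F : Set X.Edge) C) := by
    intro C
    -- A nonzero Leibniz term assigns to every vertex an incident edge of its own; this is what
    -- produces a cycle in each component.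
    rw [Matrix.det_apply] at hdet
    obtain ⟨σ, -, hσ⟩ := Finset.exists_ne_zero_of_sum_ne_zero hdet
    have hσ' : ∀ v, X.incidence (fun h => ρ (η h)) (f (σ v)) v ≠ 0 := by
      intro v h0
      apply hσ
      rw [Finset.prod_eq_zero (Finset.mem_univ v), smul_zero]
      exact h0
    have hk : ∀ v, ∃ h, X.src h = v ∧ X.edge h = f (σ v) := by
      intro v
      have h1 := hσ' v
      rw [incidence, Matrix.of_apply] at h1
      by_cases h2 : X.src (X.orient (f (σ v))) = v
      · exact ⟨_, h2, by simp⟩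
      · by_cases h3 : X.tgt (X.orient (f (σ v))) = v
        · exact ⟨X.bar (X.orient (f (σ v))), by rwa [src_bar], by simp [edge_bar]⟩
        · simp [h2, h3] at h1
    choose k hk1 hk2 using hk
    have := X.exists_isCycleOf (F := (F : Set X.Edge)) hk1 (fun v => by simp [hF, hk2])
      (fun v w h => by
        simp only [hk2] at h
        exact σ.injective (hf h)) C
    exact Classical.epsilon_spec this
  obtain ⟨k, d, hk1, hk2, hk3, hk4, hk5⟩ := X.exists_flow _ _ hcyc
  have hinj := X.edge_flow_injective hcyc hk1 hk2 hk3 hk4 hk5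
  have hflow := X.det_flow hcyc hk1 hk2 hk3 hk4 hk5 fun h => ρ (η h)
  have hτ : ∀ v, ∃ i, f i = X.edge (k v) := by
    intro v
    have := hk2 v
    simpa [hF] using this
  choose τ hτ using hτ
  have hτi : Function.Injective τ := fun v w h => hinj (by
    change X.edge (k v) = X.edge (k w)
    rw [← hτ, ← hτ, h])
  set τ' := Equiv.ofBijective τ (Finite.injective_iff_bijective.1 hτi) with hτ'
  have hr : ∀ h, ρ (η h) * ρ (η (X.bar h)) = 1 := by
    intro h
    rw [hη, ← AddChar.map_add_eq_mul]
    simp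
  choose u hu1 hu2 using X.exists_incidence_edge hr (fun h => AddChar.norm_apply ρ (η h))
  -- Reordering the rows along the flow changes the minor only by a sign and phases, both of modulus
  -- one.
  have hmat : (B.submatrix f id).submatrix τ' id = Matrix.diagonal (fun v => u (k v)) *
      Matrix.of fun v w => (if v = w then 1 else 0) - if X.tgt (k v) = w then ρ (η (k v)) else 0 := by
    ext v w
    rw [Matrix.diagonal_mul, Matrix.submatrix_apply, Matrix.submatrix_apply]
    have : f (τ' v) = X.edge (k v) := hτ v
    simp only [id_eq]
    rw [this, hB, hu2, Matrix.of_apply]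
    simp only [hk1]
  have hd := congrArg (fun M => ‖M.det‖) hmat
  simp only [Matrix.det_permute, Matrix.det_mul, Matrix.det_diagonal, norm_mul, norm_prod, hu1,
    Finset.prod_const_one, one_mul, hflow] at hd
  have hsign : ‖((Equiv.Perm.sign τ' : ℤ) : ℂ)‖ = 1 := by
    rcases Int.units_eq_one_or (Equiv.Perm.sign τ') with h | h <;> simp [h]
  rw [hsign, one_mul] at hd
  rw [hd, weight, ← Finset.prod_pow]
  refine Finset.prod_congr rfl fun C _ => ?_
  rw [compWeight]
  congr 3
  induction X.cycleOf (F : Set X.Edge) C with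
  | nil => simp
  | cons h l ih => simp [AddChar.map_add_eq_mul, ih]

/-- The twisted matrix-tree theorem. -/
theorem prod_mul_det_laplacian [Finite G] (hη : ∀ h, η (X.bar h) = -η h) (x : X.Edge → ℂ)
    (hx : ∀ e, x e ≠ 0) :
    (∏ e, x e) * (X.laplacian (fun h => ρ (η h)) fun e => (x e)⁻¹).det =
      MvPolynomial.aeval x (X.weightPolynomial η ρ) := by
  set B := X.incidence fun h => ρ (η h) with hB
  have hr : ∀ h, ρ (η h) * ρ (η (X.bar h)) = 1 := by
    intro h
    rw [hη, ← AddChar.map_add_eq_mul]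
    simp
  have hstar : ∀ h, star (ρ (η h)) = ρ (η (X.bar h)) := by
    intro h
    rw [hη, AddChar.map_neg_eq_conj]
    rfl
  rw [X.laplacian_eq hstar hr, Matrix.det_mul_eq_sum_powersetCard _ _ fun A =>
    if X.IsBasis η ρ Aᶜ then (X.weight η ρ Aᶜ : ℂ) * ∏ e ∈ A, (x e)⁻¹ else 0]
  · have hsub : ∑ A ∈ Finset.powersetCard (Fintype.card V) Finset.univ,
        (if X.IsBasis η ρ Aᶜ then (X.weight η ρ Aᶜ : ℂ) * ∏ e ∈ A, (x e)⁻¹ else 0) =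
        ∑ A : Finset X.Edge,
          if X.IsBasis η ρ Aᶜ then (X.weight η ρ Aᶜ : ℂ) * ∏ e ∈ A, (x e)⁻¹ else 0 := by
      apply Finset.sum_subset (Finset.subset_univ _)
      intro A _ hA
      refine if_neg fun h => hA ?_
      have := IsBasis.card_compl X hη h
      rw [compl_compl] at this
      rwa [Finset.mem_powersetCard_univ]
    rw [hsub, Finset.mul_sum, weightPolynomial, map_sum, Finset.sum_filter,
      ← (compl_bijective (α := Finset X.Edge)).sum_comp]
    refine Finset.sum_congr rfl fun F _ => ?_
    rw [compl_compl]
    split_ifs with h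
    · rw [map_mul, MvPolynomial.aeval_C, map_prod]
      simp only [MvPolynomial.aeval_X]
      -- The inverse lengths off `F` cancel against the full product, leaving the monomial of `F`.
      rw [← Finset.prod_mul_prod_compl F x, Finset.prod_inv_distrib]
      have : ∏ e ∈ Fᶜ, x e ≠ 0 := Finset.prod_ne_zero_iff.2 fun e _ => hx e
      change _ = (X.weight η ρ F : ℂ) * _
      field_simp
    · simp
  · intro f hf
    have h1 : (((B.conjTranspose * Matrix.diagonal fun e => (x e)⁻¹).submatrix id f).det *
        (B.submatrix f id).det) =
        ((‖(B.submatrix f id).det‖ ^ 2 : ℝ) : ℂ) * ∏ v, (x (f v))⁻¹ := by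
      have : (B.conjTranspose * Matrix.diagonal fun e => (x e)⁻¹).submatrix id f =
          (B.submatrix f id).conjTranspose * Matrix.diagonal fun v => (x (f v))⁻¹ := by
        ext v w
        rw [Matrix.submatrix_apply, Matrix.mul_diagonal, Matrix.mul_diagonal]
        rfl
      rw [this, Matrix.det_mul, Matrix.det_conjTranspose, Matrix.det_diagonal, mul_right_comm]
      congr 1
      rw [mul_comm]
      push_cast
      exact Complex.mul_conj' _
    rw [h1, Finset.prod_image fun _ _ _ _ h => hf h]
    split_ifs with h
    · rw [norm_det_incidence_sq X hη hf h]
    · have h2 : (B.submatrix f id).det = 0 := by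
        by_contra h3
        exact h ((isBasis_iff_det_ne_zero X hη hf).2 h3)
      rw [h2]
      simp

end Independence

end SGraph

/-! ### Voltages, analytic continuation and conclusion -/

/-- Reverse the lift of `h` and translate by `-η h`: it becomes the lift of `X.bar h` at its base
point, and comparing endpoints gives the claim by freeness. -/
theorem FreeCover.IsVoltage.map_bar {G : Type*} [AddCommGroup G] {V' H' V H : Type*}
    [AddAction G V'] [AddAction G H'] {X' : SGraph V' H'} {X : SGraph V H} {p : FreeCover G X' X}
    {η : H → G} (hη : p.IsVoltage η) (h : H) : η (X.bar h) = -η h := by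
  obtain ⟨σ, hσ, hlift⟩ := hη
  obtain ⟨h', ⟨hroot, rfl⟩, -⟩ := p.local_degree_one (σ (X.src h)) h (hσ _).symm
  have h1 : X'.root (X'.bar h') = η (p.onH h') +ᵥ σ (X.tgt (p.onH h')) := hlift h' hroot
  set k' := -η (p.onH h') +ᵥ X'.bar h' with hk'
  have honH : p.onH k' = X.bar (p.onH h') := by rw [hk', p.onH_vadd, p.map_bar]
  have hsrc : X'.src k' = σ (X.src (p.onH k')) := by
    rw [honH, SGraph.src_bar, SGraph.src, hk', p.vadd_root, h1, neg_vadd_vadd]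
  have htgt := hlift k' hsrc
  rw [honH, SGraph.tgt_bar, SGraph.tgt, hk', p.vadd_bar, p.vadd_root, X'.bar_bar, hroot] at htgt
  have h2 : (η (p.onH h') + η (X.bar (p.onH h'))) +ᵥ σ (X.src (p.onH h')) =
      σ (X.src (p.onH h')) := by
    rw [add_vadd, ← htgt, vadd_neg_vadd]
  exact eq_neg_of_add_eq_zero_right (p.free _ _ h2)

namespace SGraph

variable {V H : Type*} (X : SGraph V H)

theorem genus_nonneg [Fintype V] [Fintype H] (hX : X.Connected) : 0 ≤ X.genus := by
  have h1 := SimpleGraph.Connected.card_vert_le_card_edgeSet_add_one hX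
  have hex : ∀ e : (X.delete ∅).edgeSet, ∃ h, s(X.src h, X.tgt h) = e.1 := by
    rintro ⟨e, he⟩
    induction e with
    | h u v =>
      obtain ⟨-, h, -, rfl, rfl⟩ := (X.delete_adj_iff ∅).1 he
      exact ⟨h, rfl⟩
  choose k hk using hex
  have hinj : Function.Injective fun e => X.edge (k e) := by
    intro e e' hee
    refine Subtype.ext ?_
    rw [← hk, ← hk]
    rcases X.edge_eq_edge_iff.1 hee with h | h
    · rw [h]
    · rw [h, src_bar, tgt_bar, Sym2.eq_swap]
  have h2 := Nat.card_le_card_of_injective _ hinj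
  rw [Nat.card_eq_fintype_card (α := V)] at h1
  rw [Nat.card_eq_fintype_card (α := X.Edge)] at h2
  rw [genus]
  omega

variable {G : Type*} [AddCommGroup G]

/-- The half-edge weights `ρ(η(h)) s^{x_h}`. -/
def metricWeight (η : H → G) (ρ : AddChar G ℂ) (x : X.Edge → ℂ) (s : ℂ) (h : H) : ℂ :=
  ρ (η h) * s ^ x (X.edge h)

theorem prod_map_metricWeight (η : H → G) (ρ : AddChar G ℂ) (x : X.Edge → ℂ) {s : ℂ} (hs : s ≠ 0)
    (m : Multiset H) : (m.map (X.metricWeight η ρ x s)).prod =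
      ρ (m.map η).sum * s ^ (m.map fun h => x (X.edge h)).sum := by
  induction m using Multiset.induction with
  | empty => simp
  | cons h m ih =>
    simp only [Multiset.map_cons, Multiset.prod_cons, Multiset.sum_cons, ih, AddChar.map_add_eq_mul,
      Complex.cpow_add _ _ hs, metricWeight]
    ring

/-- Positive real parts make every `s ^ x e` tend to 0 at 0, and `ρ` is unitary since `G` is finite;
so near 0 the weights are small enough for the Euler product. -/
theorem isMetricLInv_det [Finite G] [Fintype H] (η : H → G) (ρ : AddChar G ℂ) (x : X.Edge → ℂ)
    (hx : ∀ e, 0 < (x e).re) :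
    X.IsMetricLInv η ρ x fun s => (1 - X.edgeMatrix (X.metricWeight η ρ x s)).det := by
  constructor
  · have hent : ∀ h k, DifferentiableOn ℂ
        (fun s => (1 - X.edgeMatrix (X.metricWeight η ρ x s)) h k) Complex.slitPlane := by
      intro h k
      simp only [Matrix.sub_apply, edgeMatrix, Matrix.of_apply, metricWeight]
      refine (differentiableOn_const _).sub ?_
      split_ifs
      · exact fun s hs => (((hasDerivAt_id s).cpow_const hs).differentiableAt.const_mul
          _).differentiableWithinAt
      · exact differentiableOn_const _
    simp only [Matrix.det_apply]
    refine DifferentiableOn.fun_sum fun σ _ => DifferentiableOn.const_smul ?_ _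
    exact DifferentiableOn.fun_finsetProd fun v _ => hent _ _
  · have hsmall : ∀ᶠ s in 𝓝 (0 : ℂ), ∀ h, Fintype.card H * ‖X.metricWeight η ρ x s h‖ < 1 := by
      rw [eventually_all]
      intro h
      have h1 : Tendsto (fun s : ℂ => s ^ x (X.edge h)) (𝓝 0) (𝓝 (0 ^ x (X.edge h))) :=
        (Complex.continuousAt_cpow_zero_of_re_pos (hx (X.edge h))).tendsto.comp
          (tendsto_id.prodMk_nhds tendsto_const_nhds)
      rw [Complex.zero_cpow (fun h0 => by have := hx (X.edge h); rw [h0] at this; simp at this)]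
        at h1
      have h2 := h1.norm.const_mul (Fintype.card H : ℝ)
      rw [norm_zero, mul_zero] at h2
      filter_upwards [h2.eventually_lt_const one_pos] with s hs
      rwa [metricWeight, norm_mul, AddChar.norm_apply, one_mul]
    filter_upwards [nhdsWithin_le_nhds hsmall, self_mem_nhdsWithin] with s hs hslit
    have hs0 : s ≠ 0 := Complex.slitPlane_ne_zero hslit
    obtain ⟨hdet, hprod⟩ := X.hasProd_prime _ hs
    have hprod' : HasProd (X.eulerFactor η ρ x s)
        ((1 - X.edgeMatrix (X.metricWeight η ρ x s)).det)⁻¹ := by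
      refine hprod.congr_fun fun P => ?_
      rw [prod_map_metricWeight _ _ _ _ hs0]
      rfl
    have hL : X.metricL η ρ x s = ((1 - X.edgeMatrix (X.metricWeight η ρ x s)).det)⁻¹ :=
      hprod'.tprod_eq
    exact ⟨hprod'.multipliable, by rw [hL]; exact inv_ne_zero hdet, by rw [hL, inv_inv]⟩

variable {X} in
-- The point 0 lies only on the boundary, so agreement near it is first moved to a neighborhood of a
-- point of the slit plane, where the identity theorem applies.
theorem IsMetricLInv.eqOn {η : H → G} {ρ : AddChar G ℂ} {x : X.Edge → ℂ} {Λ Λ' : ℂ → ℂ}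
    (h : X.IsMetricLInv η ρ x Λ) (h' : X.IsMetricLInv η ρ x Λ') :
    Set.EqOn Λ Λ' Complex.slitPlane := by
  have hev : ∀ᶠ s in 𝓝[Complex.slitPlane] (0 : ℂ), Λ s = Λ' s := by
    filter_upwards [h.euler, h'.euler] with s h1 h2
    rw [h1.2.2, h2.2.2]
  have hne : (𝓝[Complex.slitPlane] (0 : ℂ)).NeBot := by
    rw [← mem_closure_iff_nhdsWithin_neBot, Metric.mem_closure_iff]
    intro ε hε
    refine ⟨((ε / 2 : ℝ) : ℂ), Complex.ofReal_mem_slitPlane.2 (by positivity), ?_⟩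
    rw [dist_comm, dist_zero_right, Complex.norm_real, Real.norm_of_nonneg (by positivity)]
    linarith
  obtain ⟨z, hz, hzs⟩ := ((eventually_eventually_nhdsWithin.2 hev).and
    self_mem_nhdsWithin).exists
  rw [Complex.isOpen_slitPlane.nhdsWithin_eq hzs] at hz
  exact (h.differentiableOn.analyticOnNhd Complex.isOpen_slitPlane).eqOn_of_preconnected_of_eventuallyEq
    (h'.differentiableOn.analyticOnNhd Complex.isOpen_slitPlane)
    (Complex.starConvex_one_slitPlane.isPathConnected (by simp)).isConnected.isPreconnected hzs hz

end SGraph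

/-- At `a` itself, the bound requires the left side to vanish when `g ≥ 1`, which follows by
continuity; when `g = 0` the right side is 1 and nothing is required. -/
theorem isBigO_nhds_of_isBigO_nhdsNE {Λ : ℂ → ℂ} {a c : ℂ} {g : ℤ} (hg : 0 ≤ g)
    (hΛ : ContinuousAt Λ a)
    (h : (fun s => Λ s - c * (s - a) ^ (g - 1)) =O[𝓝[≠] a] fun s => (s - a) ^ g) :
    (fun s => Λ s - c * (s - a) ^ (g - 1)) =O[𝓝 a] fun s => (s - a) ^ g := by
  rw [← nhdsNE_sup_pure, isBigO_sup]
  refine ⟨h, isBigO_pure.2 fun h0 => ?_⟩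
  obtain ⟨n, rfl⟩ := Int.eq_ofNat_of_zero_le hg
  cases n with
  | zero => simp at h0
  | succ n =>
    have hn : ((n + 1 : ℕ) : ℤ) - 1 = n := by push_cast; ring
    rw [hn] at h ⊢
    simp only [zpow_natCast] at h ⊢
    have hcont : ContinuousAt (fun s => Λ s - c * (s - a) ^ n) a := by fun_prop
    have h1 : Tendsto (fun s : ℂ => (s - a) ^ (n + 1)) (𝓝[≠] a) (𝓝 0) := by
      have : ContinuousAt (fun s : ℂ => (s - a) ^ (n + 1)) a := by fun_prop
      have h2 := this.tendsto.mono_left (nhdsWithin_le_nhds (s := {a}ᶜ))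
      simpa using h2
    exact tendsto_nhds_unique (hcont.tendsto.mono_left nhdsWithin_le_nhds) (h.trans_tendsto h1)

end

theorem proposition3p9 {V H V' H' G : Type*} [Fintype V] [Fintype H] [Finite V'] [Finite H']
    [AddCommGroup G] [Finite G] [AddAction G V'] [AddAction G H']
    (X' : SGraph V' H') (X : SGraph V H) (hX : X.Connected)
    (p : FreeCover G X' X) (η : H → G) (hη : p.IsVoltage η)
    (ρ : AddChar G ℂ) (hρ : ρ ≠ 1)
    (x : X.Edge → ℂ) (hx : ∀ e, 0 < (x e).re) :
    (∃ Λ : ℂ → ℂ, X.IsMetricLInv η ρ x Λ) ∧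
    ∀ Λ : ℂ → ℂ, X.IsMetricLInv η ρ x Λ →
      (fun s : ℂ => Λ s - 2 ^ (X.genus - 1) * (-1) ^ (X.genus - 1) *
          MvPolynomial.aeval x (X.weightPolynomial η ρ) * (s - 1) ^ (X.genus - 1))
        =O[𝓝 1] fun s : ℂ => (s - 1) ^ X.genus := by

  have hbar : ∀ h, η (X.bar h) = -η h := hη.map_bar
  have hΛ₀ := X.isMetricLInv_det η ρ x hx
  refine ⟨⟨_, hΛ₀⟩, fun Λ hΛ => ?_⟩
  have h1mem : Complex.slitPlane ∈ 𝓝 (1 : ℂ) := Complex.isOpen_slitPlane.mem_nhds (by simp)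
  have hx0 : ∀ e, x e ≠ 0 := fun e h0 => by
    have := hx e
    rw [h0] at this
    simp at this
  rw [← mul_zpow, mul_neg_one]
  refine isBigO_nhds_of_isBigO_nhdsNE (X.genus_nonneg hX)
    (hΛ.differentiableOn.differentiableAt h1mem).continuousAt ?_
  have hr : ∀ h, ρ (η h) * ρ (η (X.bar h)) = 1 := by
    intro h
    rw [hbar, ← AddChar.map_add_eq_mul]
    simp
  have hO := X.isBigO_det_one_sub_edgeMatrix (fun h => ρ (η h)) hr x hx0
  rw [X.prod_mul_det_laplacian hbar x hx0] at hO
  refine hO.congr' ?_ EventuallyEq.rfl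
  filter_upwards [nhdsWithin_le_nhds h1mem] with s hs
  rw [hΛ.eqOn hΛ₀ hs]
  rfl
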